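/- **Model.** $\Omega$ is a countable (finite or infinite) totally ordered set of states. A *signal structure* consists of a set $S\subseteq\mathbb R$ that is countable or an interval and, for each $\omega\in\Omega$, a probability mass function (if $S$ is countable) or a probability density (otherwise) $f(\cdot|\omega)$ on $S$, with $f(s|\omega)>0$ for all $s\in S$, $\omega\in\Omega$, and $f(s|\cdot)$ bounded for each $s$. There is a universal set $\mathcal A$ of at least two actions, and *preferences* are given by a utility function $u:\mathcal A\times\Omega\to\mathbb R$ such that $u(a,\cdot)$ is bounded for each $a$. For a set $A\subseteq\mathcal A$ and a belief $\mu\in\Delta\Omega$, let $c(\mu)=\arg\max_{a\in A}\mathbb E_\mu[u(a,\omega)]$ and $c(\omega)=c(\delta_\omega)$. A *choice set* is a countable $A\subseteq\mathcal A$ with $|A|>1$ and $c(\mu)\ne\emptyset$ for every $\mu\in\Delta\Omega$, such that, if $\Omega$ is infinite, $u$ is bounded on $A\times\Omega$ (which is automatic if $A$ is finite). A state $\omega$ is drawn from a prior $\mu_0\in\Delta\Omega$. Agents $n=1,2,\dots$ act in sequence; agent $n$ observes the previous actions $h^n=(a_1,\dots,a_{n-1})$ and a private signal drawn independently from $f(\cdot|\omega)$,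 and chooses $a_n\in A$ according to a measurable mixed strategy $\sigma_n:S\times A^{n-1}\to\Delta A$. In an *equilibrium*, after every history of positive probability and almost every signal, $\sigma_n$ puts positive probability only on actions that maximize expected utility under the posterior given the history and the signal. The *public belief* after $h^n$ is the Bayesian posterior on $\Omega$ given $h^n$; along the random path of play it converges almost surely to a limit belief $\tilde\mu^*$. A belief $\mu$ has *adequate knowledge* if $\bigcap_{\omega\in\operatorname{supp}\mu}c(\omega)\neq\emptyset$. Given preferences and a signal structure, there is *adequate learning* if for every prior, every choice set and every equilibrium, $\tilde\mu^*$ has adequate knowledge with probability $1$; there is *inadequate learning* if for some prior and some choice set, in every equilibrium $\tilde\mu^*$ fails to have adequate knowledge with positive probability. Preferences have *single-crossing differences* (SCD) if for all $a,a'\in\mathcal A$ the function $h=u(a,\cdot)-u(a',\cdot)$ satisfies either ($h(\omega)>0\Rightarrow h(\omega')\ge0$ for all $\omega<\omega'$) or ($h(\omega)<0\Rightarrow h(\omega')\le0$ for all $\omega<\omega'$). The signal structure has *directionally unbounded beliefs* (DUB) if for every $\omega$ there are $C>0$ and sequences $(\overline s_i)$, $(\underline s_i)$ of signals such that $\frac{f(\overline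 s_i|\omega')}{f(\overline s_i|\omega)}\to0$, with all these ratios $<C$, for every $\omega'<\omega$, and $\frac{f(\underline s_i|\omega')}{f(\underline s_i|\omega)}\to0$, with all these ratios $<C$, for every $\omega'>\omega$; when $S$ is an uncountable interval this is required for every version of the densities. **Theorem.** 1. If preferences have SCD and the signal structure has DUB, then there is adequate learning. 2. If preferences fail SCD, then there is a signal structure with DUB for which there is inadequate learning. 3. If a signal structure fails DUB and $\Omega$ is finite, then there are preferences with SCD for which there is inadequate learning. -/

import Mathlib

open MeasureTheory ProbabilityTheory Filter Topology Set
open scoped ENNReal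

namespace ObsLearning

noncomputable section

universe uΩ u𝒜 uα

/-! ### Preferences, choice sets and optimal choices -/

/-- A state-dependent von Neumann–Morgenstern utility function on the universal action set `𝒜`;
the utility of each action is bounded in the state. -/
structure Preferences (𝒜 : Type u𝒜) (Ω : Type uΩ) where
  u : 𝒜 → Ω → ℝ
  bounded : ∀ a, ∃ B : ℝ, ∀ ω, |u a ω| ≤ B

variable {Ω : Type uΩ} {𝒜 : Type u𝒜}

/-- A function on an ordered set is single crossing if it switches between strictly positive and
strictly negative at most once. -/
def SingleCrossing [LinearOrder Ω] (h : Ω → ℝ) : Prop :=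
  (∀ x x', x < x' → 0 < h x → 0 ≤ h x') ∨ (∀ x x', x < x' → h x < 0 → h x' ≤ 0)

/-- Single-crossing differences. -/
def Preferences.SCD [LinearOrder Ω] (U : Preferences 𝒜 Ω) : Prop :=
  ∀ a a' : 𝒜, SingleCrossing fun ω => U.u a ω - U.u a' ω

/-- Expected utility of the action `a` under the belief `μ ∈ ΔΩ`. -/
def Preferences.expectedUtility (U : Preferences 𝒜 Ω) (μ : PMF Ω) (a : 𝒜) : ℝ :=
  ∑' ω, (μ ω).toReal * U.u a ω

/-- The choice correspondence `c(μ)` for a set `A` of available actions. -/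
def Preferences.choice (U : Preferences 𝒜 Ω) (A : Set 𝒜) (μ : PMF Ω) : Set 𝒜 :=
  {a | a ∈ A ∧ ∀ b ∈ A, U.expectedUtility μ b ≤ U.expectedUtility μ a}

/-- A choice set: countably many, and at least two, actions, such that an optimal action exists
at every belief; utility is bounded on it (automatic for finitely many actions) unless there are
only finitely many states. -/
structure ChoiceSet (U : Preferences 𝒜 Ω) where
  carrier : Set 𝒜
  countable : carrier.Countable
  nontrivial : carrier.Nontrivial
  choice_nonempty : ∀ μ : PMF Ω, (U.choice carrier μ).Nonempty
  bounded : Finite Ω ∨ ∃ B : ℝ, ∀ a ∈ carrier, ∀ ω, |U.u a ω| ≤ B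

/-- The type of the actions in a choice set, with the discrete σ-algebra. -/
abbrev ChoiceSet.Action {U : Preferences 𝒜 Ω} (A : ChoiceSet U) : Type u𝒜 := ↥A.carrier

instance ChoiceSet.instCountable {U : Preferences 𝒜 Ω} (A : ChoiceSet U) :
    Countable A.Action := A.countable.to_subtype

instance ChoiceSet.instMeasurableSpace {U : Preferences 𝒜 Ω} (A : ChoiceSet U) :
    MeasurableSpace A.Action := ⊤

instance ChoiceSet.instDiscrete {U : Preferences 𝒜 Ω} (A : ChoiceSet U) :
    DiscreteMeasurableSpace A.Action := ⟨fun _ => trivial⟩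

/-- Adequate knowledge at `μ`: some available action is optimal at every state in the support. -/
def AdequateKnowledge (U : Preferences 𝒜 Ω) (A : ChoiceSet U) (μ : PMF Ω) : Prop :=
  (⋂ ω ∈ μ.support, U.choice A.carrier (PMF.pure ω)).Nonempty

/-! ### Signal structures -/

open Classical in
/-- The reference measure on a set `S` of signals: counting measure if `S` is countable, and
Lebesgue measure otherwise. -/
def refMeasure (S : Set ℝ) : Measure ℝ :=
  if S.Countable then Measure.count.restrict S else volume.restrict S

/-- A signal structure: a set `S` of signals, countable or an interval, and for every state `ω` a
probability mass function, respectively a density, `f ω s = f(s|ω)`. No signal excludes a state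
and `f(s|·)` is bounded. The values of `f ω` outside `S` play no role. -/
structure SignalStructure (Ω : Type uΩ) where
  S : Set ℝ
  countable_or_interval : S.Countable ∨ S.OrdConnected
  f : Ω → ℝ → ℝ
  measurable : ∀ ω, Measurable (f ω)
  pos : ∀ ω, ∀ s ∈ S, 0 < f ω s
  lintegral_eq_one : ∀ ω, ∫⁻ s, ENNReal.ofReal (f ω s) ∂(refMeasure S) = 1
  bounded : ∀ s ∈ S, ∃ B : ℝ, ∀ ω, f ω s ≤ B

/-- Directionally unbounded beliefs. The requirement has to hold for every version of the
densities, that is, the sequences can be chosen outside every null set `N` (when `S` is countable,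
null sets contain no signals, and `N` plays no role). -/
def SignalStructure.DUB [LinearOrder Ω] (I : SignalStructure Ω) : Prop :=
  ∀ N : Set ℝ, refMeasure I.S N = 0 → ∀ ω, ∃ C : ℝ, 0 < C ∧ ∃ sUp sLow : ℕ → ℝ,
    (∀ i, sUp i ∈ I.S \ N) ∧ (∀ i, sLow i ∈ I.S \ N) ∧
    (∀ ω' < ω, Tendsto (fun i => I.f ω' (sUp i) / I.f ω (sUp i)) atTop (𝓝 0) ∧
      ∀ i, I.f ω' (sUp i) / I.f ω (sUp i) < C) ∧
    (∀ ω' > ω, Tendsto (fun i => I.f ω' (sLow i) / I.f ω (sLow i)) atTop (𝓝 0) ∧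
      ∀ i, I.f ω' (sLow i) / I.f ω (sLow i) < C)

/-- The distribution of a signal in the state `ω`. -/
def SignalStructure.law (I : SignalStructure Ω) (ω : Ω) : Measure ℝ :=
  (refMeasure I.S).withDensity fun s => ENNReal.ofReal (I.f ω s)

lemma SignalStructure.law_univ (I : SignalStructure Ω) (ω : Ω) : I.law ω univ = 1 := by
  simp [SignalStructure.law, I.lintegral_eq_one]

/-! ### The game -/

/-- A profile of mixed strategies. Agents are indexed by `n = 0, 1, 2, …`; agent `n` observes the
actions `h : Fin n → α` of her predecessors and a private signal `s`. -/
structure StrategyProfile (α : Type uα) where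
  prob : (n : ℕ) → (Fin n → α) → ℝ → PMF α
  measurable : ∀ n h a, Measurable fun s => prob n h s a

variable {α : Type uα} [Countable α]

/-- The distribution of agent `n`'s action in the state `ω` after the history `h`: her signal is
drawn from `f(·|ω)` independently of the history, and her action from her mixed strategy. -/
def actionProb (I : SignalStructure Ω) (σ : StrategyProfile α) (ω : Ω) (n : ℕ)
    (h : Fin n → α) : PMF α :=
  ⟨fun a => ∫⁻ s, σ.prob n h s a ∂(I.law ω), by
    have h1 : ∑' a, ∫⁻ s, σ.prob n h s a ∂(I.law ω) = 1 := by
      rw [← lintegral_tsum fun a => (σ.measurable n h a).aemeasurable]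
      simp [PMF.tsum_coe, I.law_univ]
    exact h1 ▸ ENNReal.summable.hasSum⟩

/-- The probability of the history `h` in the state `ω`. -/
def historyProb (I : SignalStructure Ω) (σ : StrategyProfile α) (ω : Ω) (n : ℕ)
    (h : Fin n → α) : ℝ≥0∞ :=
  ∏ i : Fin n, actionProb I σ ω i (fun j => h ⟨j, j.2.trans i.2⟩) (h i)

/-- The transition kernel from the actions of the agents `0, …, n` to that of agent `n + 1`. -/
def stepKernel [MeasurableSpace α] [DiscreteMeasurableSpace α] (I : SignalStructure Ω)
    (σ : StrategyProfile α) (ω : Ω) (n : ℕ) : Kernel (Finset.Iic n → α) α :=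
  Kernel.ofFunOfCountable fun x =>
    (actionProb I σ ω (n + 1)
      fun j => x ⟨j, Finset.mem_Iic.2 (Nat.lt_succ_iff.1 j.2)⟩).toMeasure

instance stepKernel.instIsMarkovKernel [MeasurableSpace α] [DiscreteMeasurableSpace α]
    (I : SignalStructure Ω) (σ : StrategyProfile α) (ω : Ω) (n : ℕ) :
    IsMarkovKernel (stepKernel I σ ω n) :=
  ⟨fun _ => PMF.toMeasure.isProbabilityMeasure _⟩

/-- The law of the infinite sequence of actions in the state `ω`. -/
def pathLaw [MeasurableSpace α] [DiscreteMeasurableSpace α] (I : SignalStructure Ω)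
    (σ : StrategyProfile α) (ω : Ω) : Measure (ℕ → α) :=
  Kernel.trajMeasure (X := fun _ => α) (actionProb I σ ω 0 Fin.elim0).toMeasure
    (stepKernel I σ ω)

/-- The law of the infinite sequence of actions when the state is drawn from the prior `μ₀`. -/
def outcomeLaw [MeasurableSpace α] [DiscreteMeasurableSpace α] (I : SignalStructure Ω)
    (μ₀ : PMF Ω) (σ : StrategyProfile α) : Measure (ℕ → α) :=
  Measure.sum fun ω => μ₀ ω • pathLaw I σ ω

open Classical in
/-- Bayes' rule: the posterior of `μ` for the likelihood function `ℓ`, if the likelihood has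
positive (and finite) probability under `μ`; otherwise the belief is left unchanged. -/
def bayes (μ : PMF Ω) (ℓ : Ω → ℝ≥0∞) : PMF Ω :=
  if h : (∑' ω, μ ω * ℓ ω) ≠ 0 ∧ (∑' ω, μ ω * ℓ ω) ≠ ∞ then
    PMF.normalize (fun ω => μ ω * ℓ ω) h.1 h.2
  else μ

/-- The public belief after the history `h`. -/
def publicBelief (I : SignalStructure Ω) (μ₀ : PMF Ω) (σ : StrategyProfile α) (n : ℕ)
    (h : Fin n → α) : PMF Ω :=
  bayes μ₀ fun ω => historyProb I σ ω n h

/-- Bayes Nash equilibrium: after every history of positive probability, and for almost every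
signal, each action that is played with positive probability maximizes the agent's expected
utility given the history and the signal. -/
def IsEquilibrium (U : Preferences 𝒜 Ω) (A : ChoiceSet U) (I : SignalStructure Ω) (μ₀ : PMF Ω)
    (σ : StrategyProfile A.Action) : Prop :=
  ∀ (n : ℕ) (h : Fin n → A.Action), (∑' ω, μ₀ ω * historyProb I σ ω n h) ≠ 0 →
    ∀ᵐ s ∂(refMeasure I.S), ∀ a : A.Action, σ.prob n h s a ≠ 0 →
      (a : 𝒜) ∈ U.choice A.carrier
        (bayes (publicBelief I μ₀ σ n h) fun ω => ENNReal.ofReal (I.f ω s))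

/-- `μ` is the limit of the public beliefs along the sequence `x` of actions. (For probability
mass functions, pointwise convergence is the same as convergence in total variation.) -/
def IsLimitBelief (I : SignalStructure Ω) (μ₀ : PMF Ω) (σ : StrategyProfile α) (x : ℕ → α)
    (μ : PMF Ω) : Prop :=
  ∀ ω, Tendsto (fun n => publicBelief I μ₀ σ n (fun i => x i) ω) atTop (𝓝 (μ ω))

/-- Adequate learning: for every prior, choice set and equilibrium, almost surely the public
belief converges and its limit has adequate knowledge. -/
def AdequateLearning (U : Preferences 𝒜 Ω) (I : SignalStructure Ω) : Prop :=
  ∀ (μ₀ : PMF Ω) (A : ChoiceSet U) (σ : StrategyProfile A.Action), IsEquilibrium U A I μ₀ σ →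
    ∀ᵐ x ∂(outcomeLaw I μ₀ σ), ∃ μ : PMF Ω, IsLimitBelief I μ₀ σ x μ ∧ AdequateKnowledge U A μ

/-- Inadequate learning: for some prior and choice set, in every equilibrium there is nonzero
probability that the limit public belief does not have adequate knowledge. -/
def InadequateLearning (U : Preferences 𝒜 Ω) (I : SignalStructure Ω) : Prop :=
  ∃ (μ₀ : PMF Ω) (A : ChoiceSet U), ∀ σ : StrategyProfile A.Action, IsEquilibrium U A I μ₀ σ →
    ∃ᵐ x ∂(outcomeLaw I μ₀ σ), ∃ μ : PMF Ω, IsLimitBelief I μ₀ σ x μ ∧ ¬ AdequateKnowledge U A μ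

end

end ObsLearning

namespace ObsLearning

noncomputable section

universe uΩ u𝒜 uα
variable {Ω : Type uΩ} {𝒜 : Type u𝒜} {α : Type uα} [Countable α]

/-! ### Probabilities of finite histories -/

/-! For sufficiency, the argument shows that in the limit private signals have no value, and that
such a limit has adequate knowledge. By Lévy's upward theorem the public belief converges almost
surely to the posterior given the whole path of actions (`ae_exists_isLimitBelief`). Utility is
measured as a nonnegative loss from a common upper bound `B`, so that all sums and integrals live in
`ℝ≥0∞`. An agent's expected loss is at least that of an observer who sees the whole path but no
signal (`lintegral_uninformedLoss_le`), because her action is part of the path. It is at most the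
loss from optimizing between any two actions given the current public belief and her signal
(`agentLoss_le`). The latter loss is upper semicontinuous in the belief, so reverse Fatou forces the
two bounds to coincide at the limit. Hence some action `a` is optimal at the limit belief after
almost every signal (`ae_limitBelief_stationary`). Comparing two actions at a time is enough for
this, and keeps the losses uniformly bounded even when those over the whole choice set are not.

Suppose now that `b` beats `a` in some state `ω` of the support. By SCD, `b` is weakly better than
`a` in all states on one side of `ω`. By DUB, some signals are overwhelming evidence for `ω` against
the other side, uniformly enough for dominated convergence, and after them `b` is strictly better, a
contradiction (`mem_choice_of_stationary`).

Both converses use a herd: with two actions, if the prior makes `a` strictly better after almost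
every signal, then everyone takes `a` and beliefs never move
(`inadequateLearning_of_unique_choice`). When SCD fails, two actions change ranking twice along
three states. Normal signals with means increasing in the state satisfy DUB, but can never isolate
the middle state from both outer ones. When DUB fails with finitely many states, some state `ω`
cannot be separated from the states on one side. A bet that pays at `ω` and loses on that side is
single crossing, yet with small enough stakes it is never taken. -/

lemma historyProb_zero (I : SignalStructure Ω) (σ : StrategyProfile α) (ω : Ω)
    (h : Fin 0 → α) : historyProb I σ ω 0 h = 1 := by
  simp [historyProb]

lemma historyProb_succ (I : SignalStructure Ω) (σ : StrategyProfile α) (ω : Ω) (n : ℕ)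
    (h : Fin (n + 1) → α) :
    historyProb I σ ω (n + 1) h =
      historyProb I σ ω n (fun i => h i.castSucc) *
        actionProb I σ ω n (fun i => h i.castSucc) (h (Fin.last n)) := by
  rw [historyProb, Fin.prod_univ_castSucc]
  rfl

lemma historyProb_le_one (I : SignalStructure Ω) (σ : StrategyProfile α) (ω : Ω) (n : ℕ)
    (h : Fin n → α) : historyProb I σ ω n h ≤ 1 :=
  Finset.prod_le_one' fun _ _ => PMF.coe_le_one _ _

lemma actionProb_apply (I : SignalStructure Ω) (σ : StrategyProfile α) (ω : Ω) (n : ℕ)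
    (h : Fin n → α) (a : α) :
    actionProb I σ ω n h a = ∫⁻ s, σ.prob n h s a ∂(I.law ω) := rfl

/-- The first `n` actions of a sequence of actions. -/
def initialActions {α : Type*} (n : ℕ) (x : ℕ → α) : Fin n → α := fun i => x i

lemma measurable_initialActions {α : Type*} [MeasurableSpace α] (n : ℕ) :
    Measurable (initialActions n : (ℕ → α) → Fin n → α) :=
  measurable_pi_lambda _ fun _ => measurable_pi_apply _

/-! ### Laws of infinite sequences of actions. -/

section Path

variable [MeasurableSpace α] [DiscreteMeasurableSpace α]

instance pathLaw.instIsProbabilityMeasure (I : SignalStructure Ω) (σ : StrategyProfile α)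
    (ω : Ω) : IsProbabilityMeasure (pathLaw I σ ω) := by
  have := PMF.toMeasure.isProbabilityMeasure (actionProb I σ ω 0 Fin.elim0)
  unfold pathLaw
  infer_instance

lemma pathLaw_first (I : SignalStructure Ω) (σ : StrategyProfile α) (ω : Ω) (a : α) :
    pathLaw I σ ω {x | x 0 = a} = actionProb I σ ω 0 Fin.elim0 a := by
  have h1 : (pathLaw I σ ω).map (Preorder.frestrictLe 0) =
      (actionProb I σ ω 0 Fin.elim0).toMeasure.map
        (MeasurableEquiv.piUnique fun _ : Finset.Iic (0 : ℕ) => α).symm := by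
    rw [pathLaw, Kernel.trajMeasure, Measure.map_comp _ _ (by fun_prop),
      Kernel.traj_map_frestrictLe_of_le le_rfl, Measure.deterministic_comp_eq_map]
    exact Measure.map_id
  have h2 : {x : ℕ → α | x 0 = a} = Preorder.frestrictLe (π := fun _ => α) 0 ⁻¹'
      {y | y ⟨0, by simp⟩ = a} := rfl
  rw [h2, ← Measure.map_apply (Preorder.measurable_frestrictLe _) (MeasurableSet.of_discrete), h1,
    Measure.map_apply (MeasurableEquiv.measurable _) (by measurability)]
  have h3 : ((MeasurableEquiv.piUnique fun _ : Finset.Iic (0 : ℕ) => α).symm ⁻¹'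
      {y | y ⟨0, by simp⟩ = a}) = {a} := by
    ext b
    rfl
  rw [h3, PMF.toMeasure_apply_singleton _ _ (by measurability)]

lemma pathLaw_history (I : SignalStructure Ω) (σ : StrategyProfile α) (ω : Ω) (n : ℕ)
    (h : Fin n → α) :
    pathLaw I σ ω (initialActions n ⁻¹' {h}) = historyProb I σ ω n h := by
  induction n with
  | zero =>
    rw [historyProb_zero, ← measure_univ (μ := pathLaw I σ ω)]
    congr 1
    ext x
    simp [Subsingleton.elim (initialActions 0 x) h]
  | succ n ih =>
    -- Agent `0` draws from the initial law and not from `stepKernel`, so histories of length one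
    -- are a separate case.
    rcases n with _ | n
    · rw [historyProb_succ, historyProb_zero, one_mul]
      have h1 : (initialActions 1 ⁻¹' {h} : Set (ℕ → α)) = {x | x 0 = h (Fin.last 0)} := by
        ext x
        simp only [mem_preimage, mem_singleton_iff, mem_ofPred_eq, funext_iff, initialActions]
        constructor
        · intro H; exact H 0
        · intro H i; rw [Subsingleton.elim i 0]; exact H
      rw [h1, pathLaw_first]
      congr 2
      exact Subsingleton.elim _ _
    · rw [historyProb_succ, ← ih]
      set y : Finset.Iic n → α := fun i =>
        h ⟨i, (Nat.lt_succ_iff.2 (Finset.mem_Iic.1 i.2)).trans (Nat.lt_succ_self _)⟩ with hy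
      have key := congrArg (fun m => m ({y} ×ˢ {h (Fin.last (n + 1))}))
        (Kernel.map_frestrictLe_trajMeasure_compProd_eq_map_trajMeasure (X := fun _ => α)
          (μ₀ := (actionProb I σ ω 0 Fin.elim0).toMeasure) (κ := stepKernel I σ ω) (a := n))
      have hp := PMF.toMeasure.isProbabilityMeasure (actionProb I σ ω 0 Fin.elim0)
      beta_reduce at key
      rw [Measure.compProd_apply_prod (by measurability) (by measurability),
        Measure.map_apply (by fun_prop) (by measurability),
        lintegral_singleton, Measure.map_apply (by fun_prop) (by measurability)] at key
      have e1 : (initialActions (n + 1 + 1) ⁻¹' {h} : Set (ℕ → α)) =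
          (fun x : ℕ → α => (Preorder.frestrictLe (π := fun _ => α) n x, x (n + 1))) ⁻¹'
            {y} ×ˢ {h (Fin.last (n + 1))} := by
        ext x
        simp only [mem_preimage, mem_singleton_iff, mem_prod, funext_iff, initialActions]
        constructor
        · intro H
          exact ⟨fun i => H ⟨i, _⟩, H (Fin.last (n + 1))⟩
        · rintro ⟨H1, H2⟩ i
          refine Fin.lastCases H2 (fun j => ?_) i
          exact H1 ⟨j, Finset.mem_Iic.2 (Nat.lt_succ_iff.1 j.2)⟩
      have e2 : (initialActions (n + 1) ⁻¹' {fun i => h i.castSucc} : Set (ℕ → α)) =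
          Preorder.frestrictLe (π := fun _ => α) n ⁻¹' {y} := by
        ext x
        simp only [mem_preimage, mem_singleton_iff, funext_iff, initialActions]
        constructor
        · intro H i
          exact H ⟨i, Nat.lt_succ_iff.2 (Finset.mem_Iic.1 i.2)⟩
        · intro H j
          exact H ⟨j, Finset.mem_Iic.2 (Nat.lt_succ_iff.1 j.2)⟩
      rw [e1, e2]
      unfold pathLaw
      rw [← key, mul_comm]
      congr 1
      change (actionProb I σ ω (n + 1) _).toMeasure _ = _
      rw [PMF.toMeasure_apply_singleton _ _ (by measurability)]
      rfl

lemma measurable_comp_initialActions {β : Type*} [MeasurableSpace β] (n : ℕ)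
    (F : (Fin n → α) → β) : Measurable fun x : ℕ → α => F (initialActions n x) :=
  (measurable_of_countable F).comp (measurable_initialActions n)

/-- Integrating over paths a function of the first `n` actions. -/
lemma lintegral_pathLaw_initialActions (I : SignalStructure Ω) (σ : StrategyProfile α) (ω : Ω)
    (n : ℕ) (F : (Fin n → α) → ℝ≥0∞) :
    ∫⁻ x, F (initialActions n x) ∂(pathLaw I σ ω) = ∑' h, historyProb I σ ω n h * F h := by
  rw [← lintegral_map (measurable_of_countable F) (measurable_initialActions n),
    lintegral_countable']
  refine tsum_congr fun h => ?_
  rw [Measure.map_apply (measurable_initialActions n) (measurableSet_singleton h),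
    pathLaw_history, mul_comm]

lemma lintegral_outcomeLaw (I : SignalStructure Ω) (μ₀ : PMF Ω) (σ : StrategyProfile α)
    (F : (ℕ → α) → ℝ≥0∞) :
    ∫⁻ x, F x ∂(outcomeLaw I μ₀ σ) = ∑' ω, μ₀ ω * ∫⁻ x, F x ∂(pathLaw I σ ω) := by
  simp [outcomeLaw, lintegral_sum_measure, lintegral_smul_measure]

lemma lintegral_outcomeLaw_initialActions (I : SignalStructure Ω) (μ₀ : PMF Ω)
    (σ : StrategyProfile α) (n : ℕ) (F : (Fin n → α) → ℝ≥0∞) :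
    ∫⁻ x, F (initialActions n x) ∂(outcomeLaw I μ₀ σ) =
      ∑' h, (∑' ω, μ₀ ω * historyProb I σ ω n h) * F h := by
  rw [lintegral_outcomeLaw]
  simp_rw [lintegral_pathLaw_initialActions, ← ENNReal.tsum_mul_left, ← ENNReal.tsum_mul_right]
  rw [ENNReal.tsum_comm]
  simp_rw [mul_assoc]

instance outcomeLaw.instIsProbabilityMeasure (I : SignalStructure Ω) (μ₀ : PMF Ω)
    (σ : StrategyProfile α) : IsProbabilityMeasure (outcomeLaw I μ₀ σ) := by
  constructor
  have := lintegral_outcomeLaw I μ₀ σ 1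
  simpa [PMF.tsum_coe] using this

end Path

/-! ### Bayes' rule -/

lemma bayes_apply (μ : PMF Ω) (ℓ : Ω → ℝ≥0∞) (h0 : (∑' ω, μ ω * ℓ ω) ≠ 0)
    (h1 : (∑' ω, μ ω * ℓ ω) ≠ ∞) (ω : Ω) :
    bayes μ ℓ ω = μ ω * ℓ ω * (∑' ω, μ ω * ℓ ω)⁻¹ := by
  rw [bayes, dif_pos ⟨h0, h1⟩, PMF.normalize_apply]

lemma bayes_mul (μ : PMF Ω) (ℓ : Ω → ℝ≥0∞) (h0 : (∑' ω, μ ω * ℓ ω) ≠ 0)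
    (h1 : (∑' ω, μ ω * ℓ ω) ≠ ∞) (ω : Ω) :
    (∑' ω, μ ω * ℓ ω) * bayes μ ℓ ω = μ ω * ℓ ω := by
  rw [bayes_apply μ ℓ h0 h1, mul_comm, mul_assoc, ENNReal.inv_mul_cancel h0 h1, mul_one]

lemma prior_mul_historyProb_ne_top (I : SignalStructure Ω) (μ₀ : PMF Ω) (σ : StrategyProfile α)
    (n : ℕ) (h : Fin n → α) : (∑' ω, μ₀ ω * historyProb I σ ω n h) ≠ ∞ := by
  refine ne_top_of_le_ne_top ENNReal.one_ne_top ?_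
  rw [← μ₀.tsum_coe]
  exact ENNReal.tsum_le_tsum fun ω => mul_le_of_le_one_right' (historyProb_le_one ..)

/-- Bayes' rule without division, which therefore also holds at histories of probability zero. -/
lemma historyProb_mul_publicBelief (I : SignalStructure Ω) (μ₀ : PMF Ω) (σ : StrategyProfile α)
    (n : ℕ) (h : Fin n → α) (ω : Ω) :
    (∑' ω, μ₀ ω * historyProb I σ ω n h) * publicBelief I μ₀ σ n h ω =
      μ₀ ω * historyProb I σ ω n h := by
  by_cases h0 : (∑' ω, μ₀ ω * historyProb I σ ω n h) = 0
  · rw [h0, zero_mul, ENNReal.tsum_eq_zero.1 h0 ω]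
  · exact bayes_mul _ _ h0 (prior_mul_historyProb_ne_top I μ₀ σ n h) ω

/-! ### Convergence of the public belief -/

section Convergence

variable [MeasurableSpace α] [DiscreteMeasurableSpace α]

/-- The filtration generated by the actions. -/
def actionFiltration (α : Type*) [MeasurableSpace α] :
    Filtration ℕ (MeasurableSpace.pi : MeasurableSpace (ℕ → α)) where
  seq n := MeasurableSpace.pi.comap (initialActions n)
  mono' m n hmn := by
    rintro _ ⟨s, hs, rfl⟩
    refine ⟨(fun y : Fin n → α => fun i : Fin m => y (Fin.castLE hmn i)) ⁻¹' s, ?_, rfl⟩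
    exact measurable_pi_lambda _ (fun _ => measurable_pi_apply _) hs
  le' n := (measurable_initialActions n).comap_le

lemma iSup_actionFiltration (α : Type*) [MeasurableSpace α] :
    ⨆ n, actionFiltration α n = MeasurableSpace.pi := by
  refine le_antisymm (iSup_le (actionFiltration α).le) (iSup_le fun n => ?_)
  refine le_trans ?_ (le_iSup (actionFiltration α) (n + 1))
  rintro _ ⟨s, hs, rfl⟩
  exact ⟨(fun y : Fin (n + 1) → α => y (Fin.last n)) ⁻¹' s, measurable_pi_apply _ hs, rfl⟩

instance isFiniteMeasure_prior_smul_pathLaw (I : SignalStructure Ω) (μ₀ : PMF Ω)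
    (σ : StrategyProfile α) (ω : Ω) : IsFiniteMeasure (μ₀ ω • pathLaw I σ ω) :=
  Measure.smul_finite _ (μ₀.apply_ne_top ω)

/-- The posterior probability of the state `ω` given the whole sequence of actions. -/
def limitDensity (I : SignalStructure Ω) (μ₀ : PMF Ω) (σ : StrategyProfile α) (ω : Ω) :
    (ℕ → α) → ℝ≥0∞ :=
  (μ₀ ω • pathLaw I σ ω).rnDeriv (outcomeLaw I μ₀ σ)

lemma measurable_limitDensity (I : SignalStructure Ω) (μ₀ : PMF Ω) (σ : StrategyProfile α)
    (ω : Ω) : Measurable (limitDensity I μ₀ σ ω) :=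
  Measure.measurable_rnDeriv _ _

lemma prior_smul_pathLaw_absolutelyContinuous (I : SignalStructure Ω) (μ₀ : PMF Ω)
    (σ : StrategyProfile α) (ω : Ω) : μ₀ ω • pathLaw I σ ω ≪ outcomeLaw I μ₀ σ :=
  (Measure.le_sum (fun ω => μ₀ ω • pathLaw I σ ω) ω).absolutelyContinuous

lemma withDensity_limitDensity (I : SignalStructure Ω) (μ₀ : PMF Ω) (σ : StrategyProfile α)
    (ω : Ω) :
    (outcomeLaw I μ₀ σ).withDensity (limitDensity I μ₀ σ ω) = μ₀ ω • pathLaw I σ ω :=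
  Measure.withDensity_rnDeriv_eq _ _ (prior_smul_pathLaw_absolutelyContinuous I μ₀ σ ω)

lemma lintegral_limitDensity_mul (I : SignalStructure Ω) (μ₀ : PMF Ω) (σ : StrategyProfile α)
    (ω : Ω) {F : (ℕ → α) → ℝ≥0∞} (hF : Measurable F) :
    ∫⁻ x, limitDensity I μ₀ σ ω x * F x ∂(outcomeLaw I μ₀ σ) =
      μ₀ ω * ∫⁻ x, F x ∂(pathLaw I σ ω) := by
  have h := lintegral_withDensity_eq_lintegral_mul (outcomeLaw I μ₀ σ)
    (measurable_limitDensity I μ₀ σ ω) hF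
  rw [withDensity_limitDensity, lintegral_smul_measure] at h
  exact h.symm

/-- The measures `μ₀ ω • pathLaw I σ ω` add up to the outcome law, so their densities add up to one.
This is what makes the limit a belief: no mass escapes when there are infinitely many states. -/
lemma tsum_limitDensity [Countable Ω] (I : SignalStructure Ω) (μ₀ : PMF Ω)
    (σ : StrategyProfile α) :
    ∀ᵐ x ∂(outcomeLaw I μ₀ σ), ∑' ω, limitDensity I μ₀ σ ω x = 1 := by
  have h : (outcomeLaw I μ₀ σ).withDensity (∑' ω, limitDensity I μ₀ σ ω) =
      (outcomeLaw I μ₀ σ).withDensity 1 := by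
    rw [withDensity_tsum (measurable_limitDensity I μ₀ σ), withDensity_one]
    simp_rw [withDensity_limitDensity]
    rfl
  have hm : Measurable (∑' ω, limitDensity I μ₀ σ ω) := by
    have h1 : ∑' ω, limitDensity I μ₀ σ ω = fun x => ∑' ω, limitDensity I μ₀ σ ω x :=
      funext fun _ => ENNReal.tsum_apply
    rw [h1]
    exact Measurable.tsum (measurable_limitDensity I μ₀ σ)
  have h2 := (withDensity_eq_iff hm.aemeasurable measurable_one.aemeasurable (by
    have := lintegral_one (μ := (outcomeLaw I μ₀ σ).withDensity (∑' ω, limitDensity I μ₀ σ ω))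
    rw [← setLIntegral_univ, ← withDensity_apply _ MeasurableSet.univ, h, withDensity_one]
    simp)).1 h
  filter_upwards [h2] with x hx
  rwa [ENNReal.tsum_apply] at hx

/-- The public belief in `ω` is the conditional expectation of `limitDensity` given the first `n`
actions, so Lévy's upward theorem applies. -/
lemma tendsto_publicBelief_toReal (I : SignalStructure Ω) (μ₀ : PMF Ω)
    (σ : StrategyProfile α) (ω : Ω) :
    ∀ᵐ x ∂(outcomeLaw I μ₀ σ), Tendsto
      (fun n => (publicBelief I μ₀ σ n (initialActions n x) ω).toReal) atTop
      (𝓝 (limitDensity I μ₀ σ ω x).toReal) := by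
  set Q := outcomeLaw I μ₀ σ
  set g : (ℕ → α) → ℝ := fun x => (limitDensity I μ₀ σ ω x).toReal
  have hg : Integrable g Q := Measure.integrable_toReal_rnDeriv
  have hgm : StronglyMeasurable[⨆ n, actionFiltration α n] g := by
    rw [iSup_actionFiltration]
    exact (measurable_limitDensity I μ₀ σ ω).ennreal_toReal.stronglyMeasurable
  have hlim := hg.tendsto_ae_condExp hgm
  have hfin : ∀ᵐ x ∂Q, limitDensity I μ₀ σ ω x < ∞ := Measure.rnDeriv_lt_top _ _
  have heq : ∀ n, (fun x => (publicBelief I μ₀ σ n (initialActions n x) ω).toReal) =ᵐ[Q]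
      Q[g | actionFiltration α n] := by
    intro n
    have hmeas : Measurable fun x => (publicBelief I μ₀ σ n (initialActions n x) ω).toReal :=
      measurable_comp_initialActions n fun h => (publicBelief I μ₀ σ n h ω).toReal
    refine ae_eq_condExp_of_forall_setIntegral_eq ((actionFiltration α).le n) hg ?_ ?_ ?_
    · intro s _ _
      refine (Integrable.of_bound hmeas.aestronglyMeasurable 1 (ae_of_all _ fun x => ?_)).integrableOn
      rw [Real.norm_of_nonneg ENNReal.toReal_nonneg]
      exact ENNReal.toReal_le_of_le_ofReal zero_le_one (by simpa using PMF.coe_le_one _ _)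
    · rintro _ ⟨C, hC, rfl⟩ _
      have hCm : MeasurableSet (initialActions n ⁻¹' C) := measurable_initialActions n hC
      rw [integral_toReal (measurable_comp_initialActions n
          fun h => publicBelief I μ₀ σ n h ω).aemeasurable
          (ae_of_all _ fun x => (PMF.apply_lt_top _ _)),
        integral_toReal (measurable_limitDensity I μ₀ σ ω).aemeasurable
          (ae_restrict_of_ae hfin)]
      congr 1
      rw [← withDensity_apply (limitDensity I μ₀ σ ω) hCm, withDensity_limitDensity,
        ← lintegral_indicator hCm]
      have e1 : (initialActions n ⁻¹' C).indicator
            (fun x => publicBelief I μ₀ σ n (initialActions n x) ω) =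
          fun x => (fun h => C.indicator 1 h * publicBelief I μ₀ σ n h ω)
            (initialActions n x) := by
        ext x
        by_cases hx : initialActions n x ∈ C <;> simp [indicator, hx]
      have e2 : (μ₀ ω • pathLaw I σ ω) (initialActions n ⁻¹' C) =
          μ₀ ω * ∫⁻ x, (fun h => C.indicator (1 : (Fin n → α) → ℝ≥0∞) h) (initialActions n x)
            ∂(pathLaw I σ ω) := by
        rw [Measure.smul_apply, smul_eq_mul, ← lintegral_indicator_one hCm]
        rfl
      rw [e1, lintegral_outcomeLaw_initialActions, e2, lintegral_pathLaw_initialActions,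
        ← ENNReal.tsum_mul_left]
      refine tsum_congr fun h => ?_
      rw [mul_left_comm, historyProb_mul_publicBelief]
      ring
    · refine StronglyMeasurable.aestronglyMeasurable ?_
      refine Measurable.stronglyMeasurable ?_
      exact (measurable_of_countable fun h => (publicBelief I μ₀ σ n h ω).toReal).comp
        (comap_measurable _)
  filter_upwards [hlim, ae_all_iff.2 heq] with x hx hx'
  exact hx.congr fun n => (hx' n).symm

/-- The public belief converges almost surely. -/
lemma ae_exists_isLimitBelief [Countable Ω] (I : SignalStructure Ω) (μ₀ : PMF Ω)
    (σ : StrategyProfile α) :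
    ∀ᵐ x ∂(outcomeLaw I μ₀ σ), ∃ μ : PMF Ω, IsLimitBelief I μ₀ σ x μ ∧
      ∀ ω, μ ω = limitDensity I μ₀ σ ω x := by
  filter_upwards [tsum_limitDensity I μ₀ σ,
    ae_all_iff.2 (tendsto_publicBelief_toReal I μ₀ σ)] with x h1 h2
  have hs : HasSum (fun ω => limitDensity I μ₀ σ ω x) 1 := h1 ▸ ENNReal.summable.hasSum
  refine ⟨⟨fun ω => limitDensity I μ₀ σ ω x, hs⟩, fun ω => ?_, fun ω => rfl⟩
  refine (ENNReal.tendsto_toReal_iff (fun n => PMF.apply_ne_top _ _) ?_).1 (h2 ω)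
  exact PMF.apply_ne_top _ _

end Convergence

/-! ### Signals -/

lemma refMeasure_ae_mem (I : SignalStructure Ω) : ∀ᵐ s ∂(refMeasure I.S), s ∈ I.S := by
  have hS : MeasurableSet I.S := I.countable_or_interval.elim (·.measurableSet) (·.measurableSet)
  unfold refMeasure
  split_ifs
  · exact ae_restrict_mem hS
  · exact ae_restrict_mem hS

lemma measurable_ofReal_f (I : SignalStructure Ω) (ω : Ω) :
    Measurable fun s => ENNReal.ofReal (I.f ω s) :=
  (I.measurable ω).ennreal_ofReal

lemma tsum_signal_ne_zero (I : SignalStructure Ω) (μ : PMF Ω) {s : ℝ} (hs : s ∈ I.S) :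
    (∑' ω, μ ω * ENNReal.ofReal (I.f ω s)) ≠ 0 := by
  obtain ⟨ω, hω⟩ := μ.support_nonempty
  intro h
  have := ENNReal.tsum_eq_zero.1 h ω
  rw [mul_eq_zero, ENNReal.ofReal_eq_zero] at this
  exact this.elim ((μ.mem_support_iff ω).1 hω) (not_le.2 (I.pos ω s hs))

lemma tsum_signal_ne_top (I : SignalStructure Ω) (μ : PMF Ω) {s : ℝ} (hs : s ∈ I.S) :
    (∑' ω, μ ω * ENNReal.ofReal (I.f ω s)) ≠ ∞ := by
  obtain ⟨B, hB⟩ := I.bounded s hs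
  refine ne_top_of_le_ne_top (b := ENNReal.ofReal B) ENNReal.ofReal_ne_top ?_
  calc (∑' ω, μ ω * ENNReal.ofReal (I.f ω s)) ≤ ∑' ω, μ ω * ENNReal.ofReal B :=
        ENNReal.tsum_le_tsum fun ω => by gcongr; exact hB ω
    _ = ENNReal.ofReal B := by rw [ENNReal.tsum_mul_right, μ.tsum_coe, one_mul]

lemma lintegral_law (I : SignalStructure Ω) (ω : Ω) {F : ℝ → ℝ≥0∞} (hF : Measurable F) :
    ∫⁻ s, F s ∂(I.law ω) = ∫⁻ s, ENNReal.ofReal (I.f ω s) * F s ∂(refMeasure I.S) :=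
  lintegral_withDensity_eq_lintegral_mul _ (measurable_ofReal_f I ω) hF

/-! ### Losses -/

lemma expectedUtility_pure (U : Preferences 𝒜 Ω) (ω : Ω) (a : 𝒜) :
    U.expectedUtility (PMF.pure ω) a = U.u a ω := by
  rw [Preferences.expectedUtility, tsum_eq_single ω]
  · simp
  · intro ω' h
    simp [h]

/-- With finitely many states an infinite choice set may have utilities unbounded below. They are
still bounded above, by the optimal utilities at the degenerate beliefs, and this suffices to define
losses. -/
lemma ChoiceSet.exists_utility_le {U : Preferences 𝒜 Ω} (A : ChoiceSet U) :
    ∃ B : ℝ, ∀ a ∈ A.carrier, ∀ ω, U.u a ω ≤ B := by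
  rcases A.bounded with hfin | ⟨B, hB⟩
  · choose a ha using fun ω => A.choice_nonempty (PMF.pure ω)
    obtain ⟨B, hB⟩ := (Set.finite_range fun ω => U.u (a ω) ω).bddAbove
    refine ⟨B, fun b hb ω => le_trans ?_ (hB ⟨ω, rfl⟩)⟩
    simpa [expectedUtility_pure] using (ha ω).2 b hb
  · exact ⟨B, fun a ha ω => (le_abs_self _).trans (hB a ha ω)⟩

/-- The shortfall of the utility of `a` from the level `B`. -/
def Preferences.loss (U : Preferences 𝒜 Ω) (B : ℝ) (a : 𝒜) (ω : Ω) : ℝ≥0∞ :=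
  ENNReal.ofReal (B - U.u a ω)

/-- The total loss from `a`, for the weights `m` on the states. -/
def Preferences.totalLoss (U : Preferences 𝒜 Ω) (B : ℝ) (m : Ω → ℝ≥0∞) (a : 𝒜) : ℝ≥0∞ :=
  ∑' ω, m ω * U.loss B a ω

/-- The weights `m` multiplied by the likelihood of the signal `s`. -/
def SignalStructure.reweight (I : SignalStructure Ω) (m : Ω → ℝ≥0∞) (s : ℝ) (ω : Ω) : ℝ≥0∞ :=
  m ω * ENNReal.ofReal (I.f ω s)

lemma Preferences.exists_loss_le (U : Preferences 𝒜 Ω) (B : ℝ) (a : 𝒜) :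
    ∃ L : ℝ≥0∞, L ≠ ∞ ∧ ∀ ω, U.loss B a ω ≤ L := by
  obtain ⟨K, hK⟩ := U.bounded a
  exact ⟨ENNReal.ofReal (B + K), ENNReal.ofReal_ne_top, fun ω =>
    ENNReal.ofReal_le_ofReal (by linarith [neg_abs_le (U.u a ω), hK ω])⟩

lemma Preferences.totalLoss_le (U : Preferences 𝒜 Ω) {B : ℝ} {a : 𝒜} {L : ℝ≥0∞}
    (hL : ∀ ω, U.loss B a ω ≤ L) (m : Ω → ℝ≥0∞) : U.totalLoss B m a ≤ (∑' ω, m ω) * L := by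
  rw [← ENNReal.tsum_mul_right]
  exact ENNReal.tsum_le_tsum fun ω => by gcongr; exact hL ω

lemma PMF.summable_toReal (μ : PMF Ω) : Summable fun ω => (μ ω).toReal :=
  ENNReal.summable_toReal μ.tsum_coe_ne_top

lemma PMF.tsum_toReal (μ : PMF Ω) : ∑' ω, (μ ω).toReal = 1 := by
  rw [← ENNReal.tsum_toReal_eq μ.apply_ne_top, μ.tsum_coe, ENNReal.toReal_one]

lemma Preferences.summable_expectedUtility (U : Preferences 𝒜 Ω) (μ : PMF Ω) (a : 𝒜) :
    Summable fun ω => (μ ω).toReal * U.u a ω := by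
  obtain ⟨K, hK⟩ := U.bounded a
  refine Summable.of_norm_bounded ((PMF.summable_toReal μ).mul_right K) fun ω => ?_
  rw [norm_mul, Real.norm_of_nonneg ENNReal.toReal_nonneg]
  exact mul_le_mul_of_nonneg_left (hK ω) ENNReal.toReal_nonneg

lemma Preferences.totalLoss_pmf (U : Preferences 𝒜 Ω) {B : ℝ} {a : 𝒜}
    (hB : ∀ ω, U.u a ω ≤ B) (μ : PMF Ω) :
    U.totalLoss B μ a = ENNReal.ofReal (B - U.expectedUtility μ a) ∧
      U.expectedUtility μ a ≤ B := by
  have e : ∀ ω, (μ ω).toReal * (B - U.u a ω) =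
      (μ ω).toReal * B - (μ ω).toReal * U.u a ω := fun ω => by ring
  have hs := (PMF.summable_toReal μ).mul_right B
  have hs' := U.summable_expectedUtility μ a
  have hnn : ∀ ω, 0 ≤ (μ ω).toReal * (B - U.u a ω) := fun ω =>
    mul_nonneg ENNReal.toReal_nonneg (sub_nonneg.2 (hB ω))
  have h : ∑' ω, (μ ω).toReal * (B - U.u a ω) = B - U.expectedUtility μ a := by
    simp_rw [e]
    rw [hs.tsum_sub hs', tsum_mul_right, PMF.tsum_toReal, one_mul, Preferences.expectedUtility]
  refine ⟨?_, sub_nonneg.1 (h ▸ tsum_nonneg hnn)⟩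
  rw [← h, ENNReal.ofReal_tsum_of_nonneg hnn (by simp_rw [e]; exact hs.sub hs'),
    Preferences.totalLoss]
  refine tsum_congr fun ω => ?_
  rw [ENNReal.ofReal_mul ENNReal.toReal_nonneg, ENNReal.ofReal_toReal (μ.apply_ne_top ω)]
  rfl

lemma Preferences.expectedUtility_le_iff (U : Preferences 𝒜 Ω) {B : ℝ} {a b : 𝒜}
    (ha : ∀ ω, U.u a ω ≤ B) (hb : ∀ ω, U.u b ω ≤ B) (μ : PMF Ω) :
    U.expectedUtility μ b ≤ U.expectedUtility μ a ↔ U.totalLoss B μ a ≤ U.totalLoss B μ b := by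
  obtain ⟨h1, -⟩ := U.totalLoss_pmf ha μ
  obtain ⟨h3, h4⟩ := U.totalLoss_pmf hb μ
  rw [h1, h3, ENNReal.ofReal_le_ofReal_iff (by linarith)]
  constructor <;> intro <;> linarith

lemma Preferences.mul_totalLoss_bayes (U : Preferences 𝒜 Ω) (B : ℝ) (μ : PMF Ω)
    (ℓ : Ω → ℝ≥0∞) (h0 : (∑' ω, μ ω * ℓ ω) ≠ 0) (h1 : (∑' ω, μ ω * ℓ ω) ≠ ∞) (a : 𝒜) :
    (∑' ω, μ ω * ℓ ω) * U.totalLoss B (bayes μ ℓ) a =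
      U.totalLoss B (fun ω => μ ω * ℓ ω) a := by
  rw [Preferences.totalLoss, ← ENNReal.tsum_mul_left]
  refine tsum_congr fun ω => ?_
  rw [← mul_assoc, bayes_mul μ ℓ h0 h1]

/-- The normalizing constant of Bayes' rule is positive and finite, so it cancels from comparisons
of losses. -/
lemma Preferences.expectedUtility_signal_le_iff (U : Preferences 𝒜 Ω) (I : SignalStructure Ω)
    {B : ℝ} {a b : 𝒜} (ha : ∀ ω, U.u a ω ≤ B) (hb : ∀ ω, U.u b ω ≤ B) (μ : PMF Ω)
    {s : ℝ} (hs : s ∈ I.S) :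
    U.expectedUtility (bayes μ fun ω => ENNReal.ofReal (I.f ω s)) b ≤
        U.expectedUtility (bayes μ fun ω => ENNReal.ofReal (I.f ω s)) a ↔
      U.totalLoss B (I.reweight μ s) a ≤ U.totalLoss B (I.reweight μ s) b := by
  have h0 := tsum_signal_ne_zero I μ hs
  have h1 := tsum_signal_ne_top I μ hs
  rw [U.expectedUtility_le_iff ha hb, ← ENNReal.mul_le_mul_iff_right h0 h1,
    U.mul_totalLoss_bayes B μ _ h0 h1, U.mul_totalLoss_bayes B μ _ h0 h1]
  rfl

/-- The expected loss of an agent with the prior weights `m` who, given her signal, takes the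
better of the two actions `a` and `b`. -/
def pairLoss (U : Preferences 𝒜 Ω) (I : SignalStructure Ω) (B : ℝ) (a b : 𝒜)
    (m : Ω → ℝ≥0∞) : ℝ≥0∞ :=
  ∫⁻ s, min (U.totalLoss B (I.reweight m s) a) (U.totalLoss B (I.reweight m s) b)
    ∂(refMeasure I.S)

/-- The least expected loss when at most two actions are used. -/
def informedLoss {U : Preferences 𝒜 Ω} (A : ChoiceSet U) (I : SignalStructure Ω) (B : ℝ)
    (m : Ω → ℝ≥0∞) : ℝ≥0∞ :=
  ⨅ (a : A.Action) (b : A.Action), pairLoss U I B a b m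

/-- The least expected loss without a signal. -/
def uninformedLoss {U : Preferences 𝒜 Ω} (A : ChoiceSet U) (B : ℝ) (m : Ω → ℝ≥0∞) : ℝ≥0∞ :=
  ⨅ a : A.Action, U.totalLoss B m a

lemma informedLoss_le_pairLoss {U : Preferences 𝒜 Ω} (A : ChoiceSet U) (I : SignalStructure Ω)
    (B : ℝ) (m : Ω → ℝ≥0∞) (a b : A.Action) : informedLoss A I B m ≤ pairLoss U I B a b m :=
  (iInf_le _ a).trans (iInf_le _ b)

/-! ### Semicontinuity of the informed loss and beliefs at which signals have no value. -/

section Stationary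

variable [Countable Ω]

lemma measurable_totalLoss_reweight (U : Preferences 𝒜 Ω) (I : SignalStructure Ω) (B : ℝ)
    (m : Ω → ℝ≥0∞) (a : 𝒜) : Measurable fun s => U.totalLoss B (I.reweight m s) a :=
  Measurable.tsum fun ω => ((measurable_ofReal_f I ω).const_mul _).mul_const _

lemma lintegral_totalLoss_reweight (U : Preferences 𝒜 Ω) (I : SignalStructure Ω) (B : ℝ)
    (m : Ω → ℝ≥0∞) (a : 𝒜) :
    ∫⁻ s, U.totalLoss B (I.reweight m s) a ∂(refMeasure I.S) = U.totalLoss B m a := by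
  unfold Preferences.totalLoss SignalStructure.reweight
  rw [lintegral_tsum fun ω =>
    (((measurable_ofReal_f I ω).const_mul _).mul_const _).aemeasurable]
  refine tsum_congr fun ω => ?_
  rw [lintegral_mul_const _ ((measurable_ofReal_f I ω).const_mul _),
    lintegral_const_mul _ (measurable_ofReal_f I ω), I.lintegral_eq_one, mul_one]

lemma pairLoss_le (U : Preferences 𝒜 Ω) (I : SignalStructure Ω) (B : ℝ) (a b : 𝒜)
    (m : Ω → ℝ≥0∞) : pairLoss U I B a b m ≤ U.totalLoss B m a := by
  rw [← lintegral_totalLoss_reweight U I]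
  exact lintegral_mono fun s => min_le_left _ _

lemma informedLoss_le {U : Preferences 𝒜 Ω} (A : ChoiceSet U) (I : SignalStructure Ω) (B : ℝ)
    (m : Ω → ℝ≥0∞) : informedLoss A I B m ≤ uninformedLoss A B m :=
  le_iInf fun a => (informedLoss_le_pairLoss A I B m a a).trans (pairLoss_le U I B a a m)

/-- Pointwise convergence of probability mass functions implies convergence in `ℓ¹`. -/
lemma PMF.tendsto_tsum_sub {p : ℕ → PMF Ω} {μ : PMF Ω}
    (h : ∀ ω, Tendsto (fun n => p n ω) atTop (𝓝 (μ ω))) :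
    Tendsto (fun n => ∑' ω, (p n ω - μ ω)) atTop (𝓝 0) := by
  let _ : MeasurableSpace Ω := ⊤
  -- Both have mass one, so the two truncated differences have equal sums. The second is dominated
  -- by `μ` uniformly in `n`.
  have e : ∀ n, ∑' ω, (p n ω - μ ω) = ∑' ω, (μ ω - p n ω) := by
    intro n
    have h1 : ∀ p q : PMF Ω, ∑' ω, (p ω - q ω) + 1 = ∑' ω, max (p ω) (q ω) := by
      intro p q
      rw [← q.tsum_coe, ← ENNReal.tsum_add]
      exact tsum_congr fun ω => tsub_add_eq_max
    have h2 : ∑' ω, (p n ω - μ ω) + 1 = ∑' ω, (μ ω - p n ω) + 1 := by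
      rw [h1, h1]
      exact tsum_congr fun ω => max_comm _ _
    exact (ENNReal.add_left_inj ENNReal.one_ne_top).1 h2
  simp_rw [e, ← lintegral_count]
  rw [← lintegral_zero (μ := (Measure.count : Measure Ω))]
  refine tendsto_lintegral_of_dominated_convergence (fun ω => μ ω) (fun n => .of_discrete)
    (fun n => ae_of_all _ fun ω => tsub_le_self) ?_ (ae_of_all _ fun ω => ?_)
  · rw [lintegral_count]
    exact μ.tsum_coe_ne_top
  · rw [← tsub_self (μ ω)]
    exact ENNReal.Tendsto.sub tendsto_const_nhds (h ω) (.inl (μ.apply_ne_top ω))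

/-- The losses of two given actions have a common bound `L`. Replacing `μ` by `p n` thus raises the
expected loss by at most `L` times the excess mass of `p n` over `μ`, which vanishes. -/
lemma limsup_pairLoss_le (U : Preferences 𝒜 Ω) (I : SignalStructure Ω) (B : ℝ) (a b : 𝒜)
    {p : ℕ → PMF Ω} {μ : PMF Ω} (h : ∀ ω, Tendsto (fun n => p n ω) atTop (𝓝 (μ ω))) :
    limsup (fun n => pairLoss U I B a b (p n)) atTop ≤ pairLoss U I B a b μ := by
  obtain ⟨La, hLa, ha⟩ := U.exists_loss_le B a
  obtain ⟨Lb, hLb, hb⟩ := U.exists_loss_le B b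
  set L := max La Lb
  have hL : L ≠ ∞ := by simp [L, hLa, hLb]
  have key : ∀ (c : 𝒜), (∀ ω, U.loss B c ω ≤ L) → ∀ n s, U.totalLoss B (I.reweight (p n) s) c ≤
      U.totalLoss B (I.reweight μ s) c +
        ∑' ω, I.reweight (fun ω => p n ω - μ ω) s ω * L := by
    intro c hc n s
    unfold Preferences.totalLoss SignalStructure.reweight
    rw [← ENNReal.tsum_add]
    refine ENNReal.tsum_le_tsum fun ω => ?_
    calc p n ω * ENNReal.ofReal (I.f ω s) * U.loss B c ω
        ≤ (μ ω + (p n ω - μ ω)) * ENNReal.ofReal (I.f ω s) * U.loss B c ω := by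
          gcongr; exact le_add_tsub
      _ = μ ω * ENNReal.ofReal (I.f ω s) * U.loss B c ω +
          (p n ω - μ ω) * ENNReal.ofReal (I.f ω s) * U.loss B c ω := by ring
      _ ≤ _ := by gcongr; exact hc ω
  have hmeas : ∀ n, Measurable fun s =>
      ∑' ω, I.reweight (fun ω => p n ω - μ ω) s ω * L := fun n =>
    Measurable.tsum fun ω => ((measurable_ofReal_f I ω).const_mul _).mul_const _
  have hbound : ∀ n, pairLoss U I B a b (p n) ≤
      pairLoss U I B a b μ + (∑' ω, (p n ω - μ ω)) * L := by
    intro n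
    have e : ∫⁻ s, ∑' ω, I.reweight (fun ω => p n ω - μ ω) s ω * L ∂(refMeasure I.S) =
        (∑' ω, (p n ω - μ ω)) * L := by
      unfold SignalStructure.reweight
      rw [lintegral_tsum fun ω =>
        (((measurable_ofReal_f I ω).const_mul _).mul_const _).aemeasurable,
        ← ENNReal.tsum_mul_right]
      refine tsum_congr fun ω => ?_
      rw [lintegral_mul_const _ ((measurable_ofReal_f I ω).const_mul _),
        lintegral_const_mul _ (measurable_ofReal_f I ω), I.lintegral_eq_one, mul_one]
    unfold pairLoss
    rw [← e, ← lintegral_add_right _ (hmeas n)]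
    refine lintegral_mono fun s => ?_
    rw [← min_add_add_right]
    exact min_le_min (key a (fun ω => (ha ω).trans (le_max_left _ _)) n s)
      (key b (fun ω => (hb ω).trans (le_max_right _ _)) n s)
  have hlim : Tendsto (fun n => pairLoss U I B a b μ + (∑' ω, (p n ω - μ ω)) * L) atTop
      (𝓝 (pairLoss U I B a b μ)) := by
    have := (ENNReal.Tendsto.mul_const (PMF.tendsto_tsum_sub h) (.inr hL)).const_add
      (pairLoss U I B a b μ)
    simpa using this
  exact (limsup_le_limsup (Eventually.of_forall hbound)).trans hlim.limsup_eq.le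

lemma limsup_informedLoss_le {U : Preferences 𝒜 Ω} (A : ChoiceSet U) (I : SignalStructure Ω)
    (B : ℝ) {p : ℕ → PMF Ω} {μ : PMF Ω} (h : ∀ ω, Tendsto (fun n => p n ω) atTop (𝓝 (μ ω))) :
    limsup (fun n => informedLoss A I B (p n)) atTop ≤ informedLoss A I B μ :=
  le_iInf₂ fun a b => (limsup_le_limsup (Eventually.of_forall fun _ =>
    informedLoss_le_pairLoss A I B _ a b)).trans
    (limsup_pairLoss_le U I B a b h)

/-- If two-action rules do not improve on ignoring the signal, then some action is optimal
after almost every signal. -/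
lemma exists_action_of_uninformedLoss_le {U : Preferences 𝒜 Ω} (A : ChoiceSet U)
    (I : SignalStructure Ω) {B : ℝ} (hB : ∀ a ∈ A.carrier, ∀ ω, U.u a ω ≤ B) (μ : PMF Ω)
    (h : uninformedLoss A B μ ≤ informedLoss A I B μ) :
    ∃ a ∈ A.carrier, ∀ b ∈ A.carrier, ∀ᵐ s ∂(refMeasure I.S),
      U.totalLoss B (I.reweight μ s) a ≤ U.totalLoss B (I.reweight μ s) b := by
  obtain ⟨a, ha, hopt⟩ := A.choice_nonempty μ
  refine ⟨a, ha, fun b hb => ?_⟩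
  have h1 : U.totalLoss B μ a ≤ uninformedLoss A B μ := le_iInf fun c =>
    (U.expectedUtility_le_iff (hB a ha) (hB c c.2) μ).1 (hopt c c.2)
  have h2 : informedLoss A I B μ ≤ pairLoss U I B a b μ :=
    informedLoss_le_pairLoss A I B μ ⟨a, ha⟩ ⟨b, hb⟩
  -- The optimal uninformed action does as well on average as the better of `a` and `b` chosen
  -- signal by signal. The latter is pointwise no worse, so the two agree almost everywhere.
  have h3 : ∫⁻ s, U.totalLoss B (I.reweight μ s) a ∂(refMeasure I.S) ≤
      pairLoss U I B a b μ := by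
    rw [lintegral_totalLoss_reweight]
    exact h1.trans (h.trans h2)
  obtain ⟨L, hL, hLa⟩ := U.exists_loss_le B a
  have hfin : pairLoss U I B a b μ ≠ ∞ := by
    refine ne_top_of_le_ne_top hL ((pairLoss_le ..).trans ((U.totalLoss_le hLa μ).trans ?_))
    rw [μ.tsum_coe, one_mul]
  have h4 := ae_eq_of_ae_le_of_lintegral_le (ae_of_all _ fun s => min_le_left _ _) hfin
    (measurable_totalLoss_reweight U I B μ a).aemeasurable h3
  filter_upwards [h4] with s hs
  exact hs ▸ min_le_right _ _

end Stationary

/-! ### Losses in equilibrium -/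

lemma tsum_historyProb_succ (I : SignalStructure Ω) (σ : StrategyProfile α) (ω : Ω) (n : ℕ)
    (F : α → ℝ≥0∞) :
    ∑' h : Fin (n + 1) → α, historyProb I σ ω (n + 1) h * F (h (Fin.last n)) =
      ∑' h : Fin n → α, historyProb I σ ω n h * ∑' a, actionProb I σ ω n h a * F a := by
  rw [← (Fin.snocEquiv fun _ => α).tsum_eq, ENNReal.tsum_prod', ENNReal.tsum_comm]
  refine tsum_congr fun h => ?_
  rw [← ENNReal.tsum_mul_left]
  refine tsum_congr fun a => ?_
  simp [historyProb_succ, Fin.snocEquiv, mul_assoc]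

section Equilibrium

variable [Countable Ω] {U : Preferences 𝒜 Ω}

/-- The ex-ante expected loss of agent `n`. -/
def agentLoss (A : ChoiceSet U) (I : SignalStructure Ω) (μ₀ : PMF Ω)
    (σ : StrategyProfile A.Action) (B : ℝ) (n : ℕ) : ℝ≥0∞ :=
  ∑' ω, μ₀ ω * ∫⁻ x, U.loss B (x n : A.Action) ω ∂(pathLaw I σ ω)

/-- The action of agent `n` is a coordinate of the path. Given the path, her expected loss is that
of one fixed action under the limit posterior, hence at least the minimum over actions. -/
lemma lintegral_uninformedLoss_le (A : ChoiceSet U) (I : SignalStructure Ω) (μ₀ : PMF Ω)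
    (σ : StrategyProfile A.Action) (B : ℝ) (n : ℕ) :
    ∫⁻ x, uninformedLoss A B (fun ω => limitDensity I μ₀ σ ω x) ∂(outcomeLaw I μ₀ σ) ≤
      agentLoss A I μ₀ σ B n := by
  have hm : ∀ ω, Measurable fun x : ℕ → A.Action => U.loss B (x n : A.Action) ω := fun ω =>
    (Measurable.of_discrete (f := fun a : A.Action => U.loss B a ω)).comp (measurable_pi_apply n)
  have e : agentLoss A I μ₀ σ B n = ∫⁻ x, U.totalLoss B (fun ω => limitDensity I μ₀ σ ω x)
      (x n : A.Action) ∂(outcomeLaw I μ₀ σ) := by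
    unfold agentLoss Preferences.totalLoss
    beta_reduce
    have hm' : ∀ ω, Measurable fun x => limitDensity I μ₀ σ ω x * U.loss B (x n : A.Action) ω :=
      fun ω => (measurable_limitDensity I μ₀ σ ω).mul (hm ω)
    rw [lintegral_tsum fun ω => (hm' ω).aemeasurable]
    exact tsum_congr fun ω => (lintegral_limitDensity_mul I μ₀ σ ω (hm ω)).symm
  rw [e]
  exact lintegral_mono fun x => iInf_le _ (x n)

/-- After almost every signal only optimal actions are played, so the conditional loss is at most
that of each of two arbitrary actions. Integration over signals gives `pairLoss`. -/
lemma tsum_strategy_le {A : ChoiceSet U} {I : SignalStructure Ω} {μ₀ : PMF Ω}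
    {σ : StrategyProfile A.Action} (hσ : IsEquilibrium U A I μ₀ σ) {B : ℝ}
    (hB : ∀ a ∈ A.carrier, ∀ ω, U.u a ω ≤ B) (n : ℕ) (h : Fin n → A.Action)
    (hh : (∑' ω, μ₀ ω * historyProb I σ ω n h) ≠ 0) :
    ∑' a : A.Action, ∑' ω, publicBelief I μ₀ σ n h ω * (actionProb I σ ω n h a * U.loss B a ω) ≤
      informedLoss A I B (publicBelief I μ₀ σ n h) := by
  set μ := publicBelief I μ₀ σ n h
  have hm : ∀ (a : A.Action) (ω : Ω), Measurable fun s =>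
      I.reweight μ s ω * U.loss B a ω * σ.prob n h s a := fun a ω =>
    (((measurable_ofReal_f I ω).const_mul _).mul_const _).mul (σ.measurable n h a)
  have e : ∑' a : A.Action, ∑' ω, μ ω * (actionProb I σ ω n h a * U.loss B a ω) =
      ∫⁻ s, ∑' a : A.Action, U.totalLoss B (I.reweight μ s) a * σ.prob n h s a
        ∂(refMeasure I.S) := by
    unfold Preferences.totalLoss
    simp_rw [← ENNReal.tsum_mul_right]
    rw [lintegral_tsum fun a => (Measurable.tsum fun ω => hm a ω).aemeasurable]
    refine tsum_congr fun a => ?_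
    rw [lintegral_tsum fun ω => (hm a ω).aemeasurable]
    refine tsum_congr fun ω => ?_
    have hm' : Measurable fun s => ENNReal.ofReal (I.f ω s) * σ.prob n h s a :=
      (measurable_ofReal_f I ω).mul (σ.measurable n h a)
    rw [actionProb_apply, lintegral_law _ _ (σ.measurable n h a),
      ← lintegral_mul_const _ hm', ← lintegral_const_mul _ (hm'.mul_const _)]
    refine lintegral_congr fun s => ?_
    unfold SignalStructure.reweight
    ring
  rw [e]
  refine le_iInf₂ fun b b' => lintegral_mono_ae ?_
  filter_upwards [hσ n h hh, refMeasure_ae_mem I] with s hs hsS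
  have key : ∀ a : A.Action, U.totalLoss B (I.reweight μ s) a * σ.prob n h s a ≤
      min (U.totalLoss B (I.reweight μ s) b) (U.totalLoss B (I.reweight μ s) b') *
        σ.prob n h s a := by
    intro a
    by_cases ha : σ.prob n h s a = 0
    · simp [ha]
    · have hopt := (hs a ha).2
      gcongr
      exact le_min
        ((U.expectedUtility_signal_le_iff I (hB a a.2) (hB b b.2) μ hsS).1 (hopt b b.2))
        ((U.expectedUtility_signal_le_iff I (hB a a.2) (hB b' b'.2) μ hsS).1 (hopt b' b'.2))
  refine (ENNReal.tsum_le_tsum key).trans ?_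
  rw [ENNReal.tsum_mul_left, PMF.tsum_coe, mul_one]

lemma agentLoss_le {A : ChoiceSet U} {I : SignalStructure Ω} {μ₀ : PMF Ω}
    {σ : StrategyProfile A.Action} (hσ : IsEquilibrium U A I μ₀ σ) {B : ℝ}
    (hB : ∀ a ∈ A.carrier, ∀ ω, U.u a ω ≤ B) (n : ℕ) :
    agentLoss A I μ₀ σ B n ≤
      ∫⁻ x, informedLoss A I B (publicBelief I μ₀ σ n (initialActions n x))
        ∂(outcomeLaw I μ₀ σ) := by
  rw [lintegral_outcomeLaw_initialActions I μ₀ σ n fun h =>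
    informedLoss A I B (publicBelief I μ₀ σ n h)]
  have e : agentLoss A I μ₀ σ B n = ∑' h : Fin n → A.Action,
      (∑' ω, μ₀ ω * historyProb I σ ω n h) * ∑' a : A.Action, ∑' ω,
        publicBelief I μ₀ σ n h ω * (actionProb I σ ω n h a * U.loss B a ω) := by
    have e1 : ∀ ω, ∫⁻ x, U.loss B (x n : A.Action) ω ∂(pathLaw I σ ω) =
        ∑' h : Fin n → A.Action, historyProb I σ ω n h *
          ∑' a, actionProb I σ ω n h a * U.loss B a ω := fun ω => by
      rw [← tsum_historyProb_succ I σ ω n fun a => U.loss B a ω,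
        ← lintegral_pathLaw_initialActions I σ ω (n + 1) fun h => U.loss B (h (Fin.last n)) ω]
      rfl
    unfold agentLoss
    simp_rw [e1, ← ENNReal.tsum_mul_left]
    rw [ENNReal.tsum_comm]
    refine tsum_congr fun h => ?_
    rw [ENNReal.tsum_comm]
    refine tsum_congr fun a => tsum_congr fun ω => ?_
    rw [← mul_assoc (∑' ω, μ₀ ω * historyProb I σ ω n h), historyProb_mul_publicBelief, mul_assoc]
  rw [e]
  refine ENNReal.tsum_le_tsum fun h => ?_
  by_cases hh : (∑' ω, μ₀ ω * historyProb I σ ω n h) = 0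
  · simp [hh]
  · gcongr
    exact tsum_strategy_le hσ hB n h hh

/-- In equilibrium, the public belief converges almost surely to a belief at which some action is
optimal after almost every signal. -/
lemma ae_limitBelief_stationary {A : ChoiceSet U} {I : SignalStructure Ω} {μ₀ : PMF Ω}
    {σ : StrategyProfile A.Action} (hσ : IsEquilibrium U A I μ₀ σ) {B : ℝ}
    (hB : ∀ a ∈ A.carrier, ∀ ω, U.u a ω ≤ B) :
    ∀ᵐ x ∂(outcomeLaw I μ₀ σ), ∃ μ : PMF Ω, IsLimitBelief I μ₀ σ x μ ∧
      ∃ a ∈ A.carrier, ∀ b ∈ A.carrier, ∀ᵐ s ∂(refMeasure I.S),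
        U.totalLoss B (I.reweight μ s) a ≤ U.totalLoss B (I.reweight μ s) b := by
  set Q := outcomeLaw I μ₀ σ
  set J : ℕ → (ℕ → A.Action) → ℝ≥0∞ := fun n x =>
    informedLoss A I B (publicBelief I μ₀ σ n (initialActions n x))
  set V : (ℕ → A.Action) → ℝ≥0∞ := fun x => uninformedLoss A B fun ω => limitDensity I μ₀ σ ω x
  obtain ⟨a₀, ha₀⟩ := A.nontrivial.nonempty
  obtain ⟨L, hL, hLa⟩ := U.exists_loss_le B a₀
  have hJL : ∀ μ : PMF Ω, informedLoss A I B μ ≤ L := fun μ =>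
    ((informedLoss_le_pairLoss A I B μ ⟨a₀, ha₀⟩ ⟨a₀, ha₀⟩).trans (pairLoss_le ..)).trans
      ((U.totalLoss_le hLa μ).trans (by rw [μ.tsum_coe, one_mul]))
  have hVm : Measurable V := by
    have : Countable A.Action := inferInstance
    exact Measurable.iInf fun a => Measurable.tsum fun ω =>
      (measurable_limitDensity I μ₀ σ ω).mul_const _
  have hJm : ∀ n, Measurable (J n) := fun n => measurable_comp_initialActions n fun h =>
    informedLoss A I B (publicBelief I μ₀ σ n h)
  have hV : ∀ n, ∫⁻ x, V x ∂Q ≤ ∫⁻ x, J n x ∂Q := fun n =>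
    (lintegral_uninformedLoss_le A I μ₀ σ B n).trans (agentLoss_le hσ hB n)
  -- Reverse Fatou, with the constant `L` as the dominating function. Together with `h2` it closes
  -- the chain E V ≤ E limsup J ≤ E V, so the integrands agree almost everywhere.
  have h1 : ∫⁻ x, V x ∂Q ≤ ∫⁻ x, limsup (fun n => J n x) atTop ∂Q :=
    (le_limsup_of_frequently_le (Frequently.of_forall hV)).trans
      (limsup_lintegral_le (fun _ => L) hJm (fun n => ae_of_all _ fun x => hJL _) (by simpa))
  have hlimit := ae_exists_isLimitBelief I μ₀ σ
  have h2 : (fun x => limsup (fun n => J n x) atTop) ≤ᵐ[Q] V := by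
    filter_upwards [hlimit] with x ⟨μ, hμ, hμ'⟩
    have : V x = uninformedLoss A B μ :=
      congrArg (uninformedLoss A B) (funext fun ω => (hμ' ω).symm)
    rw [this]
    exact (limsup_informedLoss_le A I B hμ).trans (informedLoss_le A I B μ)
  have h3 : ∫⁻ x, limsup (fun n => J n x) atTop ∂Q ≠ ∞ := by
    refine ne_top_of_le_ne_top hL ((lintegral_mono (g := fun _ => L) fun x => ?_).trans (by simp))
    exact limsup_le_of_le (h := Eventually.of_forall fun n => hJL _)
  have h4 := ae_eq_of_ae_le_of_lintegral_le h2 h3 hVm.aemeasurable h1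
  filter_upwards [hlimit, h4] with x ⟨μ, hμ, hμ'⟩ hx
  refine ⟨μ, hμ, exists_action_of_uninformedLoss_le A I hB μ ?_⟩
  have : V x = uninformedLoss A B μ :=
    congrArg (uninformedLoss A B) (funext fun ω => (hμ' ω).symm)
  rw [← this, ← hx]
  exact limsup_informedLoss_le A I B hμ

end Equilibrium

/-! ### Adequate learning -/

lemma mem_choice_pure_iff (U : Preferences 𝒜 Ω) (A : Set 𝒜) (ω : Ω) (a : 𝒜) :
    a ∈ U.choice A (PMF.pure ω) ↔ a ∈ A ∧ ∀ b ∈ A, U.u b ω ≤ U.u a ω := by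
  simp [Preferences.choice, expectedUtility_pure]

/-- A signal that is overwhelming evidence for `ω` against the states in `T` makes `b` better than
`a`, if `b` is better than `a` at `ω` and not worse outside `T`. -/
lemma exists_totalLoss_lt_of_tendsto [Countable Ω] (U : Preferences 𝒜 Ω) (I : SignalStructure Ω)
    {B : ℝ} {a b : 𝒜} (hb : ∀ ω, U.u b ω ≤ B) (μ : PMF Ω) {ω : Ω}
    (hω : ω ∈ μ.support) (hab : U.u a ω < U.u b ω) (T : Set Ω)
    (hωT : ω ∉ T)
    (hT : ∀ ω' ∉ T, U.u a ω' ≤ U.u b ω') {s : ℕ → ℝ} (hs : ∀ i, s i ∈ I.S) {C : ℝ}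
    (hlim : ∀ ω' ∈ T, Tendsto (fun i => I.f ω' (s i) / I.f ω (s i)) atTop (𝓝 0) ∧
      ∀ i, I.f ω' (s i) / I.f ω (s i) < C) :
    ∃ i, ¬ U.totalLoss B (I.reweight μ (s i)) a ≤ U.totalLoss B (I.reweight μ (s i)) b := by
  classical
  by_contra! hcon
  obtain ⟨L, hL, hLb⟩ := U.exists_loss_le B b
  set D := U.loss B a ω - U.loss B b ω
  have hD : 0 < D := tsub_pos_of_lt ((ENNReal.ofReal_lt_ofReal_iff (by linarith [hb ω])).2
    (by linarith))
  set r : ℕ → Ω → ℝ≥0∞ := fun i ω' =>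
    T.indicator (fun ω' => μ ω' * ENNReal.ofReal (I.f ω' (s i) / I.f ω (s i)) * L) ω'
  have hr : ∀ i, μ ω * D ≤ ∑' ω', r i ω' := by
    intro i
    have hf := I.pos ω (s i) (hs i)
    have hterm : ∀ ω', I.reweight μ (s i) ω' * U.loss B b ω' +
        (if ω' = ω then ENNReal.ofReal (I.f ω (s i)) * (μ ω * D) else 0) ≤
        I.reweight μ (s i) ω' * U.loss B a ω' + ENNReal.ofReal (I.f ω (s i)) * r i ω' := by
      intro ω'
      by_cases hω' : ω' ∈ T
      · rw [if_neg (by rintro rfl; exact hωT hω'), add_zero]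
        refine le_add_left ?_
        have e : ENNReal.ofReal (I.f ω (s i)) * r i ω' = I.reweight μ (s i) ω' * L := by
          simp only [r, indicator_of_mem hω', SignalStructure.reweight]
          rw [← mul_assoc, mul_left_comm, ← ENNReal.ofReal_mul hf.le, mul_div_cancel₀ _ hf.ne']
        rw [e]
        gcongr
        exact hLb ω'
      · refine le_add_right ?_
        split_ifs with h
        · subst h
          have h1 : U.loss B b ω' ≤ U.loss B a ω' :=
            ENNReal.ofReal_le_ofReal (by linarith)
          have h2 : U.loss B a ω' = U.loss B b ω' + D := (add_tsub_cancel_of_le h1).symm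
          rw [h2, SignalStructure.reweight]
          exact le_of_eq (by ring)
        · rw [add_zero]
          gcongr
          exact ENNReal.ofReal_le_ofReal (by linarith [hT ω' hω'])
    have hsum := ENNReal.tsum_le_tsum hterm
    rw [ENNReal.tsum_add, ENNReal.tsum_add, tsum_ite_eq, ENNReal.tsum_mul_left] at hsum
    have hfin : U.totalLoss B (I.reweight μ (s i)) b ≠ ∞ :=
      ne_top_of_le_ne_top (ENNReal.mul_ne_top (tsum_signal_ne_top I μ (hs i)) hL)
        (U.totalLoss_le hLb _)
    have h2 := (ENNReal.add_le_add_iff_left hfin).1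
      (hsum.trans (add_le_add_left (hcon i) _))
    exact (ENNReal.mul_le_mul_iff_right (by simpa using hf) ENNReal.ofReal_ne_top).1 h2
  let _ : MeasurableSpace Ω := ⊤
  -- Dominated convergence over the states; the uniform bound `C` on the likelihood ratios supplies
  -- the dominating function.
  have hlim' : Tendsto (fun i => ∑' ω', r i ω') atTop (𝓝 0) := by
    simp_rw [← lintegral_count]
    rw [← lintegral_zero (μ := (Measure.count : Measure Ω))]
    refine tendsto_lintegral_of_dominated_convergence (fun ω' => μ ω' * ENNReal.ofReal C * L)
      (fun n => .of_discrete) (fun n => ae_of_all _ fun ω' => ?_) ?_ (ae_of_all _ fun ω' => ?_)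
    · refine indicator_le (g := fun ω' => μ ω' * ENNReal.ofReal C * L) (fun ω' hω' => ?_) ω'
      gcongr
      exact ((hlim ω' hω').2 n).le
    · rw [lintegral_count, ENNReal.tsum_mul_right, ENNReal.tsum_mul_right, μ.tsum_coe]
      exact ENNReal.mul_ne_top (by simp) hL
    · by_cases hω' : ω' ∈ T
      · simp only [r, indicator_of_mem hω']
        have h1 := ENNReal.tendsto_ofReal (hlim ω' hω').1
        have h2 := ENNReal.Tendsto.mul_const
          (ENNReal.Tendsto.const_mul (a := μ ω') h1 (.inr (μ.apply_ne_top ω'))) (.inr hL)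
        simpa using h2
      · simp only [r, indicator_of_notMem hω']
        exact tendsto_const_nhds
  have h0 := ge_of_tendsto' hlim' hr
  exact (ENNReal.mul_pos ((μ.mem_support_iff ω).1 hω) hD.ne').not_ge h0

/-- Under single-crossing differences and directionally unbounded beliefs, an action that is
optimal after almost every signal is optimal in every state of the support. -/
lemma mem_choice_of_stationary [LinearOrder Ω] [Countable Ω] {U : Preferences 𝒜 Ω}
    {I : SignalStructure Ω} (hU : U.SCD) (hI : I.DUB) (A : ChoiceSet U) {B : ℝ}
    (hB : ∀ a ∈ A.carrier, ∀ ω, U.u a ω ≤ B) (μ : PMF Ω) {a : 𝒜} (ha : a ∈ A.carrier)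
    (hopt : ∀ b ∈ A.carrier, ∀ᵐ s ∂(refMeasure I.S),
        U.totalLoss B (I.reweight μ s) a ≤ U.totalLoss B (I.reweight μ s) b)
    {ω : Ω} (hω : ω ∈ μ.support) : a ∈ U.choice A.carrier (PMF.pure ω) := by
  refine (mem_choice_pure_iff U _ ω a).2 ⟨ha, fun b hb => ?_⟩
  by_contra! hab
  -- DUB avoids every null set, in particular the set of signals at which `a` is worse than `b`. The
  -- signals found below would lie in it.
  obtain ⟨C, -, sUp, sLow, hUp, hLow, hUp', hLow'⟩ := hI _ (ae_iff.1 (hopt b hb)) ω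
  rcases hU b a with h | h
  · obtain ⟨i, hi⟩ := exists_totalLoss_lt_of_tendsto U I (hB b hb) μ hω hab (Iio ω) (lt_irrefl ω)
      (fun ω' hω' => by
        rcases (not_lt.1 hω').eq_or_lt with rfl | h'
        · exact hab.le
        · have := h ω ω' h' (sub_pos.2 hab); linarith) (fun i => (hUp i).1) hUp'
    exact (hUp i).2 hi
  · obtain ⟨i, hi⟩ := exists_totalLoss_lt_of_tendsto U I (hB b hb) μ hω hab (Ioi ω) (lt_irrefl ω)
      (fun ω' hω' => by
        rcases (not_lt.1 hω').eq_or_lt with rfl | h'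
        · exact hab.le
        · by_contra! hlt
          have := h ω' ω h' (sub_neg.2 hlt); linarith) (fun i => (hLow i).1) hLow'
    exact (hLow i).2 hi

theorem adequateLearning_of_scd_of_dub [LinearOrder Ω] [Countable Ω] {U : Preferences 𝒜 Ω}
    {I : SignalStructure Ω} (hU : U.SCD) (hI : I.DUB) : AdequateLearning U I := by
  intro μ₀ A σ hσ
  obtain ⟨B, hB⟩ := A.exists_utility_le
  filter_upwards [ae_limitBelief_stationary hσ hB] with x ⟨μ, hμ, a, ha, hopt⟩
  exact ⟨μ, hμ, a, mem_iInter₂.2 fun ω hω => mem_choice_of_stationary hU hI A hB μ ha hopt hω⟩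

/-! ### Herds -/

lemma bayes_one (μ : PMF Ω) : bayes μ (fun _ => 1) = μ := by
  ext ω
  have h : ∑' ω, μ ω * 1 = 1 := by simp [μ.tsum_coe]
  rw [bayes_apply μ _ (by simp) (by simp), h]
  simp

lemma law_absolutelyContinuous (I : SignalStructure Ω) (ω : Ω) : I.law ω ≪ refMeasure I.S :=
  withDensity_absolutelyContinuous _ _

/-- If, at the prior, `a` is the only optimal action after almost every signal, then everyone
takes it, and nothing is learnt. -/
lemma inadequateLearning_of_unique_choice {U : Preferences 𝒜 Ω} {I : SignalStructure Ω}
    (μ₀ : PMF Ω) (A : ChoiceSet U) (a : A.Action)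
    (ha : ∀ᵐ s ∂(refMeasure I.S), ∀ b : A.Action,
      (b : 𝒜) ∈ U.choice A.carrier (bayes μ₀ fun ω => ENNReal.ofReal (I.f ω s)) → b = a)
    (hK : ¬ AdequateKnowledge U A μ₀) : InadequateLearning U I := by
  refine ⟨μ₀, A, fun σ hσ => ?_⟩
  -- If the history of all `a` is certain in every state, its likelihood is uninformative and the
  -- belief is still `μ₀`, so the next agent takes `a` too.
  have hist : ∀ n ω, historyProb I σ ω n (fun _ => a) = 1 := by
    intro n
    induction n with
    | zero => exact fun ω => historyProb_zero ..
    | succ n ih =>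
      have hb : publicBelief I μ₀ σ n (fun _ => a) = μ₀ := by
        simp only [publicBelief, ih, bayes_one]
      have hs : ∀ᵐ s ∂(refMeasure I.S), σ.prob n (fun _ => a) s a = 1 := by
        filter_upwards [ha, hσ n (fun _ => a) (by simp [ih, μ₀.tsum_coe])] with s h1 h2
        rw [hb] at h2
        refine (PMF.apply_eq_one_iff _ _).2 (Subset.antisymm (fun b hb' => ?_) ?_)
        · exact h1 b (h2 b hb')
        · obtain ⟨b, hb'⟩ := (σ.prob n (fun _ => a) s).support_nonempty
          exact singleton_subset_iff.2 ((h1 b (h2 b hb')).subst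
            (motive := fun c => c ∈ (σ.prob n (fun _ => a) s).support) hb')
      intro ω
      rw [historyProb_succ, ih, one_mul, actionProb_apply,
        lintegral_congr_ae ((law_absolutelyContinuous I ω).ae_le hs)]
      simp [I.law_univ]
  have hpath : ∀ᵐ x ∂(outcomeLaw I μ₀ σ), ∀ n, initialActions n x = fun _ => a := by
    refine ae_all_iff.2 fun n => ?_
    have hm : MeasurableSet (initialActions n ⁻¹' {fun _ => a} : Set (ℕ → A.Action)) :=
      measurable_initialActions n (measurableSet_singleton _)
    refine (prob_compl_eq_zero_iff hm).2 ?_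
    rw [← lintegral_indicator_one hm, lintegral_outcomeLaw]
    simp_rw [lintegral_indicator_one hm, pathLaw_history, hist, mul_one]
    exact μ₀.tsum_coe
  refine Eventually.frequently ?_
  filter_upwards [hpath] with x hx
  refine ⟨μ₀, fun ω => ?_, hK⟩
  have : ∀ n, publicBelief I μ₀ σ n (fun i => x i) = μ₀ := by
    intro n
    change publicBelief I μ₀ σ n (initialActions n x) = μ₀
    rw [hx n]
    simp only [publicBelief, hist, bayes_one]
  simp only [this, tendsto_const_nhds]

/-- The choice set that consists of two actions. -/
def pairChoiceSet (U : Preferences 𝒜 Ω) {a b : 𝒜} (hab : a ≠ b) : ChoiceSet U where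
  carrier := {a, b}
  countable := (toFinite _).countable
  nontrivial := nontrivial_pair hab
  choice_nonempty μ := by
    rcases le_total (U.expectedUtility μ a) (U.expectedUtility μ b) with h | h
    · exact ⟨b, by simp [Preferences.choice, h]⟩
    · exact ⟨a, by simp [Preferences.choice, h]⟩
  bounded := by
    obtain ⟨Ba, ha⟩ := U.bounded a
    obtain ⟨Bb, hb⟩ := U.bounded b
    refine .inr ⟨max Ba Bb, ?_⟩
    rintro _ (rfl | rfl) ω
    · exact (ha ω).trans (le_max_left _ _)
    · exact (hb ω).trans (le_max_right _ _)

lemma expectedUtility_signal_sub (U : Preferences 𝒜 Ω) (I : SignalStructure Ω) (a b : 𝒜)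
    (μ : PMF Ω) {s : ℝ} (hs : s ∈ I.S) :
    U.expectedUtility (bayes μ fun ω => ENNReal.ofReal (I.f ω s)) b -
        U.expectedUtility (bayes μ fun ω => ENNReal.ofReal (I.f ω s)) a =
      (∑' ω, (μ ω).toReal * I.f ω s * (U.u b ω - U.u a ω)) *
        (∑' ω, μ ω * ENNReal.ofReal (I.f ω s)).toReal⁻¹ := by
  unfold Preferences.expectedUtility
  rw [← (U.summable_expectedUtility _ b).tsum_sub (U.summable_expectedUtility _ a),
    ← tsum_mul_right]
  refine tsum_congr fun ω => ?_
  rw [bayes_apply _ _ (tsum_signal_ne_zero I μ hs) (tsum_signal_ne_top I μ hs),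
    ENNReal.toReal_mul, ENNReal.toReal_mul, ENNReal.toReal_ofReal (I.pos ω s hs).le,
    ENNReal.toReal_inv]
  ring

/-- Inadequate learning with two actions, of which `a` is the better one after every signal. -/
lemma inadequateLearning_of_pair {U : Preferences 𝒜 Ω} {I : SignalStructure Ω} (μ : PMF Ω)
    {a b : 𝒜} {ω ω' : Ω} (hω : ω ∈ μ.support) (hω' : ω' ∈ μ.support)
    (h1 : U.u a ω < U.u b ω) (h2 : U.u b ω' < U.u a ω')
    (h : ∀ᵐ s ∂(refMeasure I.S),
      ∑' ω, (μ ω).toReal * I.f ω s * (U.u b ω - U.u a ω) < 0) : InadequateLearning U I := by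
  have hab : a ≠ b := by rintro rfl; exact h1.false
  refine inadequateLearning_of_unique_choice μ (pairChoiceSet U hab) ⟨a, .inl rfl⟩ ?_ ?_
  · filter_upwards [h, refMeasure_ae_mem I] with s hs hsS
    rintro ⟨c, rfl | hc⟩ hopt
    · rfl
    · obtain rfl : c = b := hc
      have h3 := sub_nonneg.2 (hopt.2 a (.inl rfl))
      rw [expectedUtility_signal_sub U I a c μ hsS] at h3
      refine absurd h3 (not_le.2 (mul_neg_of_neg_of_pos hs (inv_pos.2 ?_)))
      exact ENNReal.toReal_pos (tsum_signal_ne_zero I μ hsS) (tsum_signal_ne_top I μ hsS)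
  · rintro ⟨c, hc⟩
    have hc1 := (mem_choice_pure_iff U _ ω c).1 (mem_iInter₂.1 hc ω hω)
    have hc2 := (mem_choice_pure_iff U _ ω' c).1 (mem_iInter₂.1 hc ω' hω')
    rcases hc1.1 with rfl | rfl
    · exact (hc1.2 b (.inr rfl)).not_gt h1
    · exact (hc2.2 a (.inl rfl)).not_gt h2

/-! ### Failure of directionally unbounded beliefs -/

lemma refMeasure_ne_zero [Nonempty Ω] (I : SignalStructure Ω) : refMeasure I.S ≠ 0 := by
  intro h
  have := I.lintegral_eq_one (Classical.arbitrary Ω)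
  simp [h] at this

/-- If the sum of the likelihood ratios on each side of each `ω` came arbitrarily close to zero off
every null set, choosing signals with sum at most `1 / (i + 1)` would give DUB. Finiteness allows
one sum to control all ratios on a side. -/
lemma exists_lt_sum_of_not_dub [LinearOrder Ω] [Fintype Ω] {I : SignalStructure Ω}
    (h : ¬ I.DUB) : ∃ (ω : Ω) (T : Finset Ω), ((∀ x, x ∈ T ↔ x < ω) ∨ ∀ x, x ∈ T ↔ ω < x) ∧
      ∃ δ > 0, ∀ᵐ s ∂(refMeasure I.S), δ < ∑ ω' ∈ T, I.f ω' s / I.f ω s := by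
  contrapose! h
  intro N hN ω
  have key : ∀ T : Finset Ω, ((∀ x, x ∈ T ↔ x < ω) ∨ ∀ x, x ∈ T ↔ ω < x) →
      ∃ s : ℕ → ℝ, (∀ i, s i ∈ I.S \ N) ∧ ∀ ω' ∈ T,
        Tendsto (fun i => I.f ω' (s i) / I.f ω (s i)) atTop (𝓝 0) ∧
          ∀ i, I.f ω' (s i) / I.f ω (s i) < 2 := by
    intro T hT
    have hex : ∀ i : ℕ, ∃ s ∈ I.S \ N, ∑ ω' ∈ T, I.f ω' s / I.f ω s ≤ 1 / ((i : ℝ) + 1) := by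
      intro i
      have h1 := h ω T hT (1 / ((i : ℝ) + 1)) (by positivity)
      have hN' : ∀ᵐ s ∂(refMeasure I.S), s ∉ N := measure_eq_zero_iff_ae_notMem.1 hN
      obtain ⟨s, hs1, hs2, hs3⟩ := (h1.and_eventually ((refMeasure_ae_mem I).and hN')).exists
      exact ⟨s, ⟨hs2, hs3⟩, hs1⟩
    choose s hs hsum using hex
    have hle : ∀ ω' ∈ T, ∀ i, I.f ω' (s i) / I.f ω (s i) ≤ 1 / ((i : ℝ) + 1) := fun ω' hω' i =>
      (Finset.single_le_sum (f := fun ω' => I.f ω' (s i) / I.f ω (s i))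
        (fun x _ => (div_pos (I.pos x _ (hs i).1) (I.pos ω _ (hs i).1)).le) hω').trans (hsum i)
    refine ⟨s, hs, fun ω' hω' => ⟨?_, fun i => (hle ω' hω' i).trans_lt ?_⟩⟩
    · exact squeeze_zero (fun i => (div_pos (I.pos ω' _ (hs i).1) (I.pos ω _ (hs i).1)).le)
        (hle ω' hω') tendsto_one_div_add_atTop_nhds_zero_nat
    · rw [div_lt_iff₀ (by positivity)]
      have : (0 : ℝ) ≤ i := i.cast_nonneg
      linarith
  obtain ⟨sUp, hUp, hUp'⟩ := key (Finset.univ.filter (· < ω)) (.inl (by simp))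
  obtain ⟨sLow, hLow, hLow'⟩ := key (Finset.univ.filter (ω < ·)) (.inr (by simp))
  exact ⟨2, two_pos, sUp, sLow, hUp, hLow, fun ω' hω' => hUp' ω' (by simpa using hω'),
    fun ω' hω' => hLow' ω' (by simpa using hω')⟩

lemma SingleCrossing.neg [LinearOrder Ω] {h : Ω → ℝ} (hh : SingleCrossing h) :
    SingleCrossing fun ω => -h ω := by
  rcases hh with hh | hh
  · exact .inr fun x x' hx h0 => by have := hh x x' hx (by linarith); linarith
  · exact .inl fun x x' hx h0 => by have := hh x x' hx (by linarith); linarith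

open Classical in
/-- The preferences for which `b` yields `w` and all other actions yield zero. -/
def Preferences.single [Finite Ω] (b : 𝒜) (w : Ω → ℝ) : Preferences 𝒜 Ω where
  u x ω := if x = b then w ω else 0
  bounded x := by
    obtain ⟨B, hB⟩ := (finite_range fun ω => |if x = b then w ω else 0|).bddAbove
    exact ⟨B, fun ω => hB ⟨ω, rfl⟩⟩

lemma Preferences.scd_single [LinearOrder Ω] [Finite Ω] (b : 𝒜) {w : Ω → ℝ}
    (hw : SingleCrossing w) : (Preferences.single b w).SCD := by
  intro x y
  have h0 : SingleCrossing fun _ : Ω => (0 : ℝ) := .inl fun _ _ _ _ => le_rfl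
  by_cases hx : x = b <;> by_cases hy : y = b
  · simpa [Preferences.single, hx, hy] using h0
  · simpa [Preferences.single, hx, hy] using hw
  · simpa [Preferences.single, hx, hy] using hw.neg
  · simpa [Preferences.single, hx, hy] using h0

theorem exists_scd_inadequateLearning [LinearOrder Ω] [Finite Ω] [Nontrivial 𝒜]
    {I : SignalStructure Ω} (hI : ¬ I.DUB) :
    ∃ U : Preferences 𝒜 Ω, U.SCD ∧ InadequateLearning U I := by
  have := Fintype.ofFinite Ω
  obtain ⟨ω, T, hT, δ, hδ, hs⟩ := exists_lt_sum_of_not_dub hI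
  obtain ⟨a, b, hab⟩ := exists_pair_ne 𝒜
  have : Nonempty Ω := ⟨ω⟩
  have : (ae (refMeasure I.S)).NeBot := ae_neBot.2 (refMeasure_ne_zero I)
  have hωT : ω ∉ T := by rcases hT with hT | hT <;> simp [hT]
  obtain ⟨t, ht⟩ : T.Nonempty := by
    obtain ⟨s, hs⟩ := hs.exists
    by_contra hne
    rw [Finset.not_nonempty_iff_eq_empty.1 hne, Finset.sum_empty] at hs
    exact hs.not_gt hδ
  -- All of `T` lies on one side of `ω` and exhausts it, so `w` changes sign once. Under a uniform
  -- prior, `b` beats `a` only if `δ` is at least the sum of likelihood ratios over `T`, which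
  -- almost no signal allows.
  set w : Ω → ℝ := fun x => if x ∈ T then -1 else if x = ω then δ else 0 with hw
  have hwT : ∀ x ∈ T, w x = -1 := fun x hx => by simp [hw, hx]
  have hwω : w ω = δ := by simp [hw, hωT]
  have hwn : ∀ x, x ∉ T → x ≠ ω → w x = 0 := fun x h1 h2 => by simp [hw, h1, h2]
  have hsc : SingleCrossing w := by
    rcases hT with hT | hT
    · refine .inl fun x x' hx h0 => ?_
      have h1 : x ∉ T := fun h1 => by rw [hwT x h1] at h0; linarith
      have h2 : ω < x' := (not_lt.1 fun h => h1 ((hT x).2 h)).trans_lt hx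
      exact (hwn x' (fun h => ((hT x').1 h).not_gt h2) h2.ne').ge
    · refine .inr fun x x' hx h0 => ?_
      have h1 : x ∈ T := by
        by_contra h1
        by_cases h2 : x = ω
        · rw [h2, hwω] at h0; linarith
        · exact h0.ne (hwn x h1 h2)
      rw [hwT x' ((hT x').2 (((hT x).1 h1).trans hx))]
      norm_num
  refine ⟨Preferences.single b w, Preferences.scd_single b hsc, ?_⟩
  have hu : ∀ x, (Preferences.single b w).u b x = w x := fun x => by simp [Preferences.single]
  have hu0 : ∀ x, (Preferences.single b w).u a x = 0 := fun x => by simp [Preferences.single, hab]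
  refine inadequateLearning_of_pair (PMF.uniformOfFintype Ω) (a := a) (b := b) (ω := ω) (ω' := t)
    (by simp) (by simp) (by rw [hu, hu0, hwω]; exact hδ)
    (by rw [hu, hu0, hwT t ht]; norm_num) ?_
  filter_upwards [hs, refMeasure_ae_mem I] with s hs hsS
  have hf := I.pos ω s hsS
  have hc : 0 < (Fintype.card Ω : ℝ)⁻¹ := by positivity
  rw [tsum_fintype]
  have e : ∀ x, ((PMF.uniformOfFintype Ω) x).toReal * I.f x s *
      ((Preferences.single b w).u b x - (Preferences.single b w).u a x) =
      (Fintype.card Ω : ℝ)⁻¹ * I.f ω s *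
        ((if x = ω then δ else 0) - if x ∈ T then I.f x s / I.f ω s else 0) := by
    intro x
    rw [hu, hu0, sub_zero, PMF.uniformOfFintype_apply, ENNReal.toReal_inv, ENNReal.toReal_natCast]
    by_cases h1 : x ∈ T
    · have h2 : x ≠ ω := by rintro rfl; exact hωT h1
      rw [hwT x h1, if_neg h2, if_pos h1]
      field_simp
      ring
    · by_cases h2 : x = ω
      · subst h2
        rw [hwω, if_pos rfl, if_neg h1]
        ring
      · rw [hwn x h1 h2, if_neg h2, if_neg h1]
        ring
  simp_rw [e]
  rw [← Finset.mul_sum, Finset.sum_sub_distrib, Finset.sum_ite_eq' Finset.univ ω,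
    if_pos (Finset.mem_univ _), Finset.sum_ite_mem, Finset.univ_inter]
  exact mul_neg_of_pos_of_neg (mul_pos hc hf) (sub_neg.2 hs)

/-! ### Normal signals -/

lemma gaussianPDFReal_div (m m' s : ℝ) :
    gaussianPDFReal m' 1 s / gaussianPDFReal m 1 s =
      Real.exp (s * (m' - m) + (m ^ 2 - m' ^ 2) / 2) := by
  rw [div_eq_iff (gaussianPDFReal_pos m 1 s one_ne_zero).ne', gaussianPDFReal, gaussianPDFReal,
    mul_left_comm, ← Real.exp_add]
  congr 2
  simp only [NNReal.coe_one]
  ring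

lemma refMeasure_univ : refMeasure univ = volume := by
  rw [refMeasure, if_neg not_countable_univ, Measure.restrict_univ]

/-- Signals that are normally distributed with unit variance around a state-dependent mean. -/
def normalSignals (g : Ω → ℝ) : SignalStructure Ω where
  S := univ
  countable_or_interval := .inr ordConnected_univ
  f ω := gaussianPDFReal (g ω) 1
  measurable ω := measurable_gaussianPDFReal _ _
  pos ω s _ := gaussianPDFReal_pos _ _ _ one_ne_zero
  lintegral_eq_one ω := by
    rw [refMeasure_univ]
    exact lintegral_gaussianPDFReal_eq_one _ one_ne_zero
  bounded s _ := by
    refine ⟨(√(2 * Real.pi * (1 : NNReal)))⁻¹, fun ω => ?_⟩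
    rw [gaussianPDFReal]
    refine mul_le_of_le_one_right (by positivity) (Real.exp_le_one_iff.2 ?_)
    exact div_nonpos_of_nonpos_of_nonneg (neg_nonpos.2 (sq_nonneg _)) (by positivity)

lemma exists_mem_Icc_notMem {N : Set ℝ} (hN : volume N = 0) (a : ℝ) :
    ∃ s ∈ Icc a (a + 1), s ∉ N := by
  by_contra! h
  have h1 : volume (Icc a (a + 1)) ≤ volume N := measure_mono h
  rw [hN, Real.volume_Icc] at h1
  simp at h1

/-- Likelihood ratios are exponentials of affine functions of the signal whose slope is the
difference of the means. Large signals discredit all lower states and very negative ones all higher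
states. -/
lemma dub_normalSignals [LinearOrder Ω] {g : Ω → ℝ} (hg : StrictMono g) :
    (normalSignals g).DUB := by
  intro N hN ω
  change refMeasure univ N = 0 at hN
  rw [refMeasure_univ] at hN
  choose sUp hUp hUpN using fun i : ℕ => exists_mem_Icc_notMem hN i
  -- The interval is `[-i - 1, -i]`, so these signals are nonpositive already at `i = 0`, as the
  -- bound `hlt` requires.
  choose sLow hLow hLowN using fun i : ℕ => exists_mem_Icc_notMem hN (-i - 1)
  have hUp_lim : Tendsto sUp atTop atTop :=
    tendsto_atTop_mono (fun i => (hUp i).1) tendsto_natCast_atTop_atTop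
  have hLow_lim : Tendsto sLow atTop atBot :=
    tendsto_atBot_mono (fun i => (hLow i).2.trans_eq (sub_add_cancel _ _))
      (tendsto_neg_atTop_atBot.comp tendsto_natCast_atTop_atTop)
  have hlt : ∀ (s m : ℝ), s * (m - g ω) ≤ 0 →
      Real.exp (s * (m - g ω) + (g ω ^ 2 - m ^ 2) / 2) < Real.exp (g ω ^ 2 / 2) + 1 := by
    intro s m h
    refine lt_of_le_of_lt (Real.exp_le_exp.2 ?_) (lt_add_one _)
    linarith [sq_nonneg m]
  refine ⟨Real.exp (g ω ^ 2 / 2) + 1, by positivity, sUp, sLow, fun i => ⟨trivial, hUpN i⟩,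
    fun i => ⟨trivial, hLowN i⟩, fun ω' hω' => ?_, fun ω' hω' => ?_⟩
  · have hneg : g ω' - g ω < 0 := sub_neg.2 (hg hω')
    simp only [normalSignals, gaussianPDFReal_div]
    refine ⟨Real.tendsto_exp_atBot.comp
      (tendsto_atBot_add_const_right _ _ (hUp_lim.atTop_mul_const_of_neg hneg)), fun i => ?_⟩
    exact hlt _ _ (mul_nonpos_of_nonneg_of_nonpos (i.cast_nonneg.trans (hUp i).1) hneg.le)
  · have hpos : 0 < g ω' - g ω := sub_pos.2 (hg hω')
    simp only [normalSignals, gaussianPDFReal_div]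
    refine ⟨Real.tendsto_exp_atBot.comp
      (tendsto_atBot_add_const_right _ _ (hLow_lim.atBot_mul_const hpos)), fun i => ?_⟩
    refine hlt _ _ (mul_nonpos_of_nonpos_of_nonneg ?_ hpos.le)
    have : (0 : ℝ) ≤ i := i.cast_nonneg
    linarith [(hLow i).2]

/-- The density of an intermediate mean is dominated by those of the extreme means. -/
lemma exists_gaussianPDFReal_lt {m₁ m₂ m₃ : ℝ} (h₁ : m₁ < m₂) (h₂ : m₂ < m₃) :
    ∃ K > 0, ∀ s, gaussianPDFReal m₂ 1 s < K * (gaussianPDFReal m₁ 1 s + gaussianPDFReal m₃ 1 s) := by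
  refine ⟨Real.exp ((m₁ ^ 2 + m₃ ^ 2) / 2), Real.exp_pos _, fun s => ?_⟩
  have hp : ∀ m, 0 < gaussianPDFReal m 1 s := fun m => gaussianPDFReal_pos m 1 s one_ne_zero
  have hK := Real.exp_pos ((m₁ ^ 2 + m₃ ^ 2) / 2)
  -- Whatever the sign of `s`, one outer mean makes the linear term of the exponent nonpositive, and
  -- the quadratic term is at most the exponent of the constant.
  have key : ∀ m, s * (m₂ - m) ≤ 0 → m ^ 2 ≤ m₁ ^ 2 + m₃ ^ 2 →
      gaussianPDFReal m₂ 1 s ≤ Real.exp ((m₁ ^ 2 + m₃ ^ 2) / 2) * gaussianPDFReal m 1 s := by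
    intro m h hm
    rw [← div_le_iff₀ (hp m), gaussianPDFReal_div]
    refine Real.exp_le_exp.2 ?_
    linarith [sq_nonneg m₂]
  rw [mul_add]
  rcases le_total s 0 with hs | hs
  · have := key m₁ (mul_nonpos_of_nonpos_of_nonneg hs (by linarith)) (by linarith [sq_nonneg m₃])
    linarith [mul_pos hK (hp m₃)]
  · have := key m₃ (mul_nonpos_of_nonneg_of_nonpos hs (by linarith)) (by linarith [sq_nonneg m₁])
    linarith [mul_pos hK (hp m₁)]

/-! ### Failure of single-crossing differences -/

/-- Positive weights on a finite set of states can be normalized to a belief. -/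
lemma exists_pmf_of_weights (t : Finset Ω) (ht : t.Nonempty) (v : Ω → ℝ) (hv : ∀ ω ∈ t, 0 < v ω) :
    ∃ (μ : PMF Ω) (c : ℝ), 0 < c ∧ (∀ ω, ω ∈ μ.support ↔ ω ∈ t) ∧
      ∀ ω ∈ t, (μ ω).toReal = c * v ω := by
  classical
  have hV : 0 < ∑ ω ∈ t, v ω := Finset.sum_pos hv ht
  set c := (∑ ω ∈ t, v ω)⁻¹ with hc
  have hc0 : 0 < c := inv_pos.2 hV
  refine ⟨PMF.ofFinset (fun ω => if ω ∈ t then ENNReal.ofReal (c * v ω) else 0) t ?_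
    (fun ω hω => if_neg hω), c, hc0, fun ω => ?_, fun ω hω => ?_⟩
  · rw [Finset.sum_congr rfl fun ω hω => if_pos hω,
      ← ENNReal.ofReal_sum_of_nonneg fun ω hω => (mul_pos hc0 (hv ω hω)).le, ← Finset.mul_sum, hc,
      inv_mul_cancel₀ hV.ne', ENNReal.ofReal_one]
  · rw [PMF.mem_support_iff, PMF.ofFinset_apply]
    by_cases hω : ω ∈ t
    · simp [hω, mul_pos hc0 (hv ω hω)]
    · simp [hω]
  · rw [PMF.ofFinset_apply, if_pos hω, ENNReal.toReal_ofReal (mul_pos hc0 (hv ω hω)).le]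

lemma inadequateLearning_normalSignals [LinearOrder Ω] {U : Preferences 𝒜 Ω} {g : Ω → ℝ}
    (hg : StrictMono g) {a b : 𝒜} {ω₁ ω₂ ω₃ : Ω} (h₁₂ : ω₁ < ω₂) (h₂₃ : ω₂ < ω₃)
    (h₁ : U.u b ω₁ < U.u a ω₁) (h₂ : U.u a ω₂ < U.u b ω₂) (h₃ : U.u b ω₃ < U.u a ω₃) :
    InadequateLearning U (normalSignals g) := by
  obtain ⟨K, hK, hdom⟩ := exists_gaussianPDFReal_lt (hg h₁₂) (hg h₂₃)
  have n12 := h₁₂.ne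
  have n23 := h₂₃.ne
  have n13 := (h₁₂.trans h₂₃).ne
  set d := U.u b ω₂ - U.u a ω₂
  have hd : 0 < d := sub_pos.2 h₂
  -- Weights inverse to the utility gaps at the outer states make the gain from `b` a positive
  -- multiple of f(s|ω₂) - K (f(s|ω₁) + f(s|ω₃)), which is negative for every signal.
  set v : Ω → ℝ := fun ω => if ω = ω₂ then 1 else K * d / (U.u a ω - U.u b ω)
  have v2 : v ω₂ = 1 := if_pos rfl
  have v1 : v ω₁ = K * d / (U.u a ω₁ - U.u b ω₁) := if_neg n12
  have v3 : v ω₃ = K * d / (U.u a ω₃ - U.u b ω₃) := if_neg n23.symm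
  have p1 := sub_pos.2 h₁
  have p3 := sub_pos.2 h₃
  obtain ⟨μ, c, hc, hsupp, hμ⟩ := exists_pmf_of_weights {ω₁, ω₂, ω₃} (by simp) v (by
    simp only [Finset.mem_insert, Finset.mem_singleton]
    rintro ω (rfl | rfl | rfl)
    · rw [v1]; positivity
    · rw [v2]; exact one_pos
    · rw [v3]; positivity)
  refine inadequateLearning_of_pair μ (a := a) (b := b) (ω := ω₂) (ω' := ω₁)
    ((hsupp _).2 (by simp)) ((hsupp _).2 (by simp)) h₂ h₁ (ae_of_all _ fun s => ?_)
  rw [tsum_eq_sum (s := {ω₁, ω₂, ω₃}) fun ω hω => by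
    rw [← hsupp, PMF.mem_support_iff, not_not] at hω
    simp [hω]]
  rw [Finset.sum_insert (by simp [n12, n13]), Finset.sum_insert (by simp [n23]),
    Finset.sum_singleton, hμ ω₁ (by simp), hμ ω₂ (by simp), hμ ω₃ (by simp), v1, v2, v3]
  have e : c * (K * d / (U.u a ω₁ - U.u b ω₁)) * (normalSignals g).f ω₁ s *
        (U.u b ω₁ - U.u a ω₁) + (c * 1 * (normalSignals g).f ω₂ s * (U.u b ω₂ - U.u a ω₂) +
        c * (K * d / (U.u a ω₃ - U.u b ω₃)) * (normalSignals g).f ω₃ s *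
        (U.u b ω₃ - U.u a ω₃)) =
      c * d * ((normalSignals g).f ω₂ s -
        K * ((normalSignals g).f ω₁ s + (normalSignals g).f ω₃ s)) := by
    rw [← neg_sub (U.u a ω₁), ← neg_sub (U.u a ω₃)]
    have q1 := p1.ne'
    have q3 := p3.ne'
    field_simp
    ring
  rw [e]
  exact mul_neg_of_pos_of_neg (mul_pos hc hd) (sub_neg.2 (hdom s))

theorem exists_dub_inadequateLearning [LinearOrder Ω] [Countable Ω] {U : Preferences 𝒜 Ω}
    (hU : ¬ U.SCD) : ∃ I : SignalStructure Ω, I.DUB ∧ InadequateLearning U I := by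
  -- A countable linear order embeds in the reals, which provides strictly increasing means.
  obtain ⟨g⟩ := Order.embedding_from_countable_to_dense Ω ℝ
  refine ⟨normalSignals g, dub_normalSignals g.strictMono, ?_⟩
  simp only [Preferences.SCD, SingleCrossing, not_forall, not_or, not_le] at hU
  obtain ⟨a, b, ⟨x, x', hx, h1, h2⟩, y, y', hy, h3, h4⟩ := hU
  -- The utility difference falls from positive to negative on `x < x'` and rises from negative to
  -- positive on `y < y'`. The lower of `x'` and `y'` is the middle of a triple with alternating
  -- signs.
  rcases lt_trichotomy x' y' with h | rfl | h
  · exact inadequateLearning_normalSignals g.strictMono (a := a) (b := b) hx h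
      (by linarith) (by linarith) (by linarith)
  · linarith
  · exact inadequateLearning_normalSignals g.strictMono (a := b) (b := a) hy h
      (by linarith) (by linarith) (by linarith)

end

end ObsLearning

theorem theorem1 {Ω : Type*} [LinearOrder Ω] [Countable Ω] {𝒜 : Type*} [Nontrivial 𝒜] :
    (∀ (U : ObsLearning.Preferences 𝒜 Ω) (I : ObsLearning.SignalStructure Ω),
        U.SCD → I.DUB → ObsLearning.AdequateLearning U I) ∧
    (∀ U : ObsLearning.Preferences 𝒜 Ω, ¬ U.SCD →
        ∃ I : ObsLearning.SignalStructure Ω, I.DUB ∧ ObsLearning.InadequateLearning U I) ∧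
    (Finite Ω → ∀ I : ObsLearning.SignalStructure Ω, ¬ I.DUB →
        ∃ U : ObsLearning.Preferences 𝒜 Ω, U.SCD ∧ ObsLearning.InadequateLearning U I) :=
  ⟨fun _ _ => ObsLearning.adequateLearning_of_scd_of_dub,
    fun _ => ObsLearning.exists_dub_inadequateLearning,
    fun _ _ => ObsLearning.exists_scd_inadequateLearning⟩
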